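/- **Type soundness for a core calculus with row-polymorphic types.** Fix a set of labels $l$, a countably infinite set of type variables $\alpha$, and a set of term variables $x$. Notions with binders are taken up to renaming of bound variables. Lists of label-term pairs have distinct labels and their order is insignificant; likewise the order of the label-type pairs with distinct labels in a row is insignificant (anywhere inside a type), i.e. types that differ only in this order are identified. An index $i$ ranges over a finite, possibly empty set. *Terms.* $e ::= x \mid e_1\,e_2 \mid \lambda x = e \mid \mathbf{let}\ f = e_1\ \mathbf{in}\ e_2 \mid \mathbf{fix} \mid l\,e \mid \{\overline{l_i:e_i}\} \mid e.l \mid e.{-}l \mid e.\{\overline{l_i:e_i}\} \mid e.{+}\{\overline{l_i:e_i}\} \mid \mathbf{match}\ e\ \mathbf{with}\ \langle\rangle \mid \mathbf{match}\ e\ \mathbf{with}\ \langle\{\cdot\}\Rightarrow e_1\rangle \mid \mathbf{match}\ e\ \mathbf{with}\ \langle l\,x_1\Rightarrow e_1 \mid x_2\Rightarrow e_2\rangle$. *Kinds and types.* Kinds are $\mathcal T$ and the row kinds $\mathcal R ::= L \mid \neg L$, with $L$ a finite set of labels. Types $t ::= \alpha \mid \tau \mid \alpha\ \mathbf{as}\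 \tau$ with contractive types $\tau ::= t_1\to t_2 \mid \{\rho\} \mid \langle\rho\rangle$; rows $\rho ::= \alpha \mid \cdot \mid (l:t\mid\rho)$; schemes $\sigma ::= t \mid \forall(\alpha:\kappa).\sigma$. Kinding environments $\Delta$ are finite maps from type variables to kinds, where $\Delta,\alpha:\kappa$ maps $\alpha$ to $\kappa$ (overriding any earlier binding); typing environments $\Gamma$ are finite maps from term variables to schemes. *Row kinds.* $L\sqsubseteq M$ iff $L\subseteq M$; $\neg L\sqsubseteq\neg M$ iff $M\subseteq L$; $L\sqsubseteq\neg M$ iff $L\cap M=\emptyset$; never $\neg L\sqsubseteq M$. The partial operation $+$ is: $L+l=L\cup\{l\}$ if $l\notin L$; $\neg L+l=\neg(L\setminus\{l\})$ if $l\in L$. *Kinding* $\Delta\vdash t:\kappa$. $\alpha:\Delta(\alpha)$; $t_1\to t_2:\mathcal T$ if $t_1,t_2:\mathcal T$; $\{\rho\}:\mathcal T$ and $\langle\rho\rangle:\mathcal T$ if $\rho$ has some row kind; $\alpha\ \mathbf{as}\ \tau:\mathcal T$ if $\Delta,\alpha:\mathcal T\vdash\tau:\mathcal T$; $\cdot:\{\}$;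 $(l:t\mid\rho):\mathcal R+l$ if $\rho:\mathcal R$, $t:\mathcal T$ and $\mathcal R+l$ is defined. A scheme is well-kinded if its body has kind $\mathcal T$ in $\Delta$ extended with the quantified variables. *Instantiation* $\Delta\vdash\sigma\preceq\sigma'$ is the least reflexive and transitive relation with $\forall(\alpha:\mathcal T).\sigma\preceq\sigma[\alpha\mapsto t]$ if $\Delta\vdash t:\mathcal T$, and $\forall(\alpha:\mathcal R).\sigma\preceq\sigma[\alpha\mapsto\rho]$ if $\Delta\vdash\rho:\mathcal R'$ and $\mathcal R'\sqsubseteq\mathcal R$. *Typing* $\Delta;\Gamma\vdash e:t$. In every judgment of a derivation, $t$ has kind $\mathcal T$ in $\Delta$ and all schemes in $\Gamma$ are well-kinded in $\Delta$. The rules are as follows (a premise without environments uses $\Delta;\Gamma$). - $x:t$ if $\Delta\vdash\Gamma(x)\preceq t$. - $f\,e:t_2$ if $f:t_1\to t_2$ and $e:t_1$. - $\lambda x=e:t_1\to t_2$ if $\Delta;\Gamma,x:t_1\vdash e:t_2$. - $\mathbf{let}\ f=e_1\ \mathbf{in}\ e_2:t_2$ if $\{\overline{\alpha_i}\}=\mathrm{ftv}(t_1)\setminus\mathrm{ftv}(\Gamma)$,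 $\Delta,\overline{\alpha_i:\kappa_i};\Gamma\vdash e_1:t_1$ and $\Delta;\Gamma,f:\overline{\forall(\alpha_i:\kappa_i).}\,t_1\vdash e_2:t_2$. - $\mathbf{fix}:((t_1\to t_2)\to t_1\to t_2)\to t_1\to t_2$. - $l\,e:\langle l:t\mid\rho\rangle$ if $e:t$, $\Delta\vdash\rho:\mathcal R$ and $\mathcal R\sqsubseteq\neg\{l\}$. - From $e:\alpha\ \mathbf{as}\ \tau$ infer $e:\tau[\alpha\mapsto\alpha\ \mathbf{as}\ \tau]$, and conversely. - $\{\overline{l_i:e_i}\}:\{\overline{l_i:t_i}\mid\cdot\}$ if $e_i:t_i$ for all $i$. - $e.\{\overline{l_i:e_i}\}:\{\overline{l_i:t_i}\mid\rho\}$ if $e:\{\overline{l_i:t_i}\mid\rho\}$ and $e_i:t_i$ for all $i$. - $e.{+}\{\overline{l_i:e_i}\}:\{\overline{l_i:t_i}\mid\rho\}$ if $e:\{\rho\}$, $\Delta\vdash\rho:\mathcal R$, $\mathcal R\sqsubseteq\neg\{\overline{l_i}\}$ and $e_i:t_i$ for all $i$. - $e.l:t$ and $e.{-}l:\{\rho\}$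 if $e:\{l:t\mid\rho\}$. - $\mathbf{match}\ e\ \mathbf{with}\ \langle\rangle:t$ (any $t$) if $e:\langle\cdot\rangle$. - $\mathbf{match}\ e\ \mathbf{with}\ \langle\{\cdot\}\Rightarrow e_1\rangle:t$ if $e:\{\cdot\}$ and $e_1:t$. - $\mathbf{match}\ e\ \mathbf{with}\ \langle l\,x_1\Rightarrow e_1\mid x_2\Rightarrow e_2\rangle:t'$ if $\{\overline{\alpha_i}\}=\mathrm{ftv}(t)\setminus\mathrm{ftv}(\Gamma)$, $\{\overline{\beta_j}\}=\mathrm{ftv}(\langle\rho\rangle)\setminus\mathrm{ftv}(\Gamma)$, $\Delta,\overline{\alpha_i:\kappa_i}\cup\overline{\beta_j:\kappa'_j};\Gamma\vdash e:\langle l:t\mid\rho\rangle$ (with the same kind for a variable in both lists), $\Delta;\Gamma,x_1:\overline{\forall(\alpha_i:\kappa_i).}\,t\vdash e_1:t'$ and $\Delta;\Gamma,x_2:\overline{\forall(\beta_j:\kappa'_j).}\,\langle\rho\rangle\vdash e_2:t'$. *Semantics.* Values: $v ::= l\,v\mid\{\overline{l_i:v_i}\}\mid\lambda x=e\mid\mathbf{fix}$.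 Evaluation contexts: $E ::= []\mid E\,e\mid v\,E\mid\mathbf{let}\ f=E\ \mathbf{in}\ e\mid l\,E\mid\{\overline{l_i:v_i}\mid l:E\mid\overline{l_j:e_j}\}\mid E.l\mid E.{-}l\mid E.[{+}]\{\overline{l_i:e_i}\}\mid v.[{+}]\{\overline{l_i:v_i}\mid l:E\mid\overline{l_j:e_j}\}\mid\mathbf{match}\ E\ \mathbf{with}\ \langle\dots\rangle$ (all three forms of match; $[{+}]$ is an optional $+$). Reductions $\rightsquigarrow$: - $(\lambda x=e)\,v\rightsquigarrow e[x\mapsto v]$; $\ \mathbf{let}\ f=v\ \mathbf{in}\ e\rightsquigarrow e[f\mapsto v]$; $\ \mathbf{fix}\,v\rightsquigarrow v\,(\lambda x=\mathbf{fix}\,v\,x)$ with $x$ not free in $v$. - $\{l:v\mid\overline{l_j:v_j}\}.l\rightsquigarrow v$; $\ \{l:v\mid\overline{l_j:v_j}\}.{-}l\rightsquigarrow\{\overline{l_j:v_j}\}$. - $\{\overline{l_i:v_i}\mid\overline{l_j:v_j}\}.\{\overline{l_i:v'_i}\}\rightsquigarrow\{\overline{l_i:v'_i}\mid\overline{l_j:v_j}\}$;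 $\ \{\overline{l_i:v_i}\}.{+}\{\overline{l_j:v_j}\}\rightsquigarrow\{\overline{l_i:v_i}\mid\overline{l_j:v_j}\}$. - $\mathbf{match}\ \{\}\ \mathbf{with}\ \langle\{\cdot\}\Rightarrow e\rangle\rightsquigarrow e$. - $\mathbf{match}\ l\,v\ \mathbf{with}\ \langle l\,x_1\Rightarrow e_1\mid x_2\Rightarrow e_2\rangle\rightsquigarrow e_1[x_1\mapsto v]$. - $\mathbf{match}\ l\,v\ \mathbf{with}\ \langle l'\,x_1\Rightarrow e_1\mid x_2\Rightarrow e_2\rangle\rightsquigarrow e_2[x_2\mapsto l\,v]$ if $l\neq l'$. The stepping relation is: $E[e_1]\rightarrowtail E[e_2]$ whenever $e_1\rightsquigarrow e_2$. **Theorem.** For every kinding environment $\Delta$, term $e$ and type $t$: if $\Delta;\cdot\vdash e:t$ (with the empty typing environment), then either $e$ is a value, or there exists a term $\hat e$ such that $e\rightarrowtail\hat e$ and $\Delta;\cdot\vdash\hat e:t$. -/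

import Mathlib

/-! A core calculus for ELEVATE: syntax, kinding, typing and small-step semantics.

* `Label` is the set of labels.
* Term variables are de Bruijn indices.
* Type variables are locally nameless: free ones are names (`ℕ`), those bound by `α as τ` or by a
  quantifier of a type scheme are de Bruijn indices. Types and schemes are thereby identified up to
  renaming of bound variables. -/

namespace Elevate

universe u

/-! ### Kinds -/

/-- Row kinds: a finite set `L` of labels, or its complement `¬ L`. -/
inductive RowKind (Label : Type u) : Type u
  | pos (L : Finset Label)
  | neg (L : Finset Label)

/-- Kinds: the kind of ordinary types, and the row kinds. -/
inductive Kind (Label : Type u) : Type u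
  | type
  | row (R : RowKind Label)

/-- The row kind subset relation `R ⊑ R'`. -/
inductive RowKind.Sub {Label : Type u} : RowKind Label → RowKind Label → Prop
  | pp {L M : Finset Label} : L ⊆ M → Sub (.pos L) (.pos M)
  | nn {L M : Finset Label} : M ⊆ L → Sub (.neg L) (.neg M)
  | pn {L M : Finset Label} : Disjoint L M → Sub (.pos L) (.neg M)

/-- The (partial) row kind extension operator: `R.Ext l R'` is `R + l = R'`. -/
inductive RowKind.Ext {Label : Type u} [DecidableEq Label] :
    RowKind Label → Label → RowKind Label → Prop
  | pos {L : Finset Label} {l : Label} : l ∉ L → Ext (.pos L) l (.pos (insert l L))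
  | neg {L : Finset Label} {l : Label} : l ∈ L → Ext (.neg L) l (.neg (L.erase l))

/-! ### Types and type schemes -/

/-- Raw types and rows. The kinding relation below separates ordinary types
(`α`, `t₁ → t₂`, `{ρ}`, `⟨ρ⟩`, `α as τ`) from rows (`α`, `·`, `l : t ∣ ρ`). -/
inductive Ty (Label : Type u) : Type u
  | fvar (a : ℕ)
  | bvar (n : ℕ)
  | arrow (t₁ t₂ : Ty Label)
  | record (ρ : Ty Label)
  | variant (ρ : Ty Label)
  | mu (τ : Ty Label)
  | empty
  | cons (l : Label) (t ρ : Ty Label)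

/-- Type schemes `σ ::= t ∣ ∀ (α : κ). σ`. -/
inductive Scheme (Label : Type u) : Type u
  | mono (t : Ty Label)
  | all (κ : Kind Label) (σ : Scheme Label)

namespace Ty

variable {Label : Type u}

/-- Function, record and variant types: the types that may stand under `α as`. -/
inductive Contractive : Ty Label → Prop
  | arrow (t₁ t₂ : Ty Label) : Contractive (.arrow t₁ t₂)
  | record (ρ : Ty Label) : Contractive (.record ρ)
  | variant (ρ : Ty Label) : Contractive (.variant ρ)

/-- The free type variables. -/
def ftv : Ty Label → Finset ℕ
  | fvar a => {a}
  | bvar _ => ∅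
  | arrow t₁ t₂ => t₁.ftv ∪ t₂.ftv
  | record ρ => ρ.ftv
  | variant ρ => ρ.ftv
  | mu τ => τ.ftv
  | empty => ∅
  | cons _ t ρ => t.ftv ∪ ρ.ftv

/-- `inst k u t` replaces the bound variable that is number `k` at the root of `t` by `u`
(which has no dangling indices wherever this is used). -/
def inst (k : ℕ) (u : Ty Label) : Ty Label → Ty Label
  | fvar a => fvar a
  | bvar n => if n = k then u else bvar n
  | arrow t₁ t₂ => arrow (inst k u t₁) (inst k u t₂)
  | record ρ => record (inst k u ρ)
  | variant ρ => variant (inst k u ρ)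
  | mu τ => mu (inst (k + 1) u τ)
  | empty => empty
  | cons l t ρ => cons l (inst k u t) (inst k u ρ)

/-- `close k a t` turns the free variable `a` into the bound variable number `k`. -/
def close (k : ℕ) (a : ℕ) : Ty Label → Ty Label
  | fvar b => if b = a then bvar k else fvar b
  | bvar n => bvar n
  | arrow t₁ t₂ => arrow (close k a t₁) (close k a t₂)
  | record ρ => record (close k a ρ)
  | variant ρ => variant (close k a ρ)
  | mu τ => mu (close (k + 1) a τ)
  | empty => empty
  | cons l t ρ => cons l (close k a t) (close k a ρ)

/-- `τ[α ↦ α as τ]`, the unrolling of `α as τ`. -/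
def unroll (τ : Ty Label) : Ty Label := inst 0 (mu τ) τ

/-- The row `l₁ : t₁ ∣ … ∣ lₙ : tₙ ∣ ρ` where `l₁, …, lₙ` are the elements of `L`, in some order
(the order does not matter, see `Equiv`). -/
noncomputable def fields (L : Finset Label) (t : L → Ty Label) (ρ : Ty Label) : Ty Label :=
  L.attach.toList.foldr (fun l r => cons l.1 (t l) r) ρ

/-- Equality of types up to the order of the label-type pairs in rows, at any depth. -/
inductive Equiv : Ty Label → Ty Label → Prop
  | refl (t : Ty Label) : Equiv t t
  | symm {t t' : Ty Label} : Equiv t t' → Equiv t' t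
  | trans {t t' t'' : Ty Label} : Equiv t t' → Equiv t' t'' → Equiv t t''
  | swap {l l' : Label} (t t' ρ : Ty Label) : l ≠ l' →
      Equiv (.cons l t (.cons l' t' ρ)) (.cons l' t' (.cons l t ρ))
  | arrow {t₁ t₂ t₁' t₂' : Ty Label} :
      Equiv t₁ t₁' → Equiv t₂ t₂' → Equiv (.arrow t₁ t₂) (.arrow t₁' t₂')
  | record {ρ ρ' : Ty Label} : Equiv ρ ρ' → Equiv (.record ρ) (.record ρ')
  | variant {ρ ρ' : Ty Label} : Equiv ρ ρ' → Equiv (.variant ρ) (.variant ρ')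
  | mu {τ τ' : Ty Label} : Equiv τ τ' → Equiv (.mu τ) (.mu τ')
  | cons (l : Label) {t t' ρ ρ' : Ty Label} :
      Equiv t t' → Equiv ρ ρ' → Equiv (.cons l t ρ) (.cons l t' ρ')

end Ty

namespace Scheme

variable {Label : Type u}

/-- The free type variables. -/
def ftv : Scheme Label → Finset ℕ
  | mono t => t.ftv
  | all _ σ => σ.ftv

/-- Replaces the bound variable that is number `k` at the root by `u`. If the scheme
`∀ (α : κ). σ` is `all κ s`, then `σ[α ↦ u]` is `s.inst 0 u`. -/
def inst (k : ℕ) (u : Ty Label) : Scheme Label → Scheme Label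
  | mono t => mono (Ty.inst k u t)
  | all κ σ => all κ (inst (k + 1) u σ)

/-- Turns the free variable `a` into the bound variable number `k`. -/
def close (k : ℕ) (a : ℕ) : Scheme Label → Scheme Label
  | mono t => mono (t.close k a)
  | all κ σ => all κ (close (k + 1) a σ)

/-- The scheme `∀ (α₁ : κ₁). … ∀ (αₙ : κₙ). t`, where `κᵢ = ks αᵢ`. -/
def gen (ks : ℕ → Kind Label) : List ℕ → Ty Label → Scheme Label
  | [], t => mono t
  | a :: as, t => all (ks a) ((gen ks as t).close 0 a)

end Scheme

/-! ### Environments and kinding -/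

/-- Kinding environments `Δ`; the most recent binding is at the head and shadows older ones. -/
abbrev KEnv (Label : Type u) : Type u := List (ℕ × Kind Label)

/-- The environment `Δ, α₁ : κ₁, …, αₙ : κₙ`, where `κᵢ = ks αᵢ`. -/
def KEnv.extend {Label : Type u} (Δ : KEnv Label) (ks : ℕ → Kind Label) (as : List ℕ) :
    KEnv Label :=
  as.map (fun a => (a, ks a)) ++ Δ

/-- Typing environments `Γ`; the variable with de Bruijn index `n` has the `n`-th scheme. -/
abbrev TEnv (Label : Type u) : Type u := List (Scheme Label)

/-- The free type variables of a typing environment. -/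
def TEnv.ftv {Label : Type u} : TEnv Label → Finset ℕ
  | [] => ∅
  | σ :: Γ => σ.ftv ∪ TEnv.ftv Γ

/-- Kinding `Δ ⊢ t : κ`. The list `B` holds the kinds of the type variables that are bound outside
of `t`, innermost first; it is the part of the kinding environment whose variables are indices.
The judgment `Δ ⊢ t : κ` proper is the case `B = []`. -/
inductive HasKind {Label : Type u} [DecidableEq Label] (Δ : KEnv Label) :
    List (Kind Label) → Ty Label → Kind Label → Prop
  | fvar {B : List (Kind Label)} {a : ℕ} {κ : Kind Label} :
      List.lookup a Δ = some κ → HasKind Δ B (.fvar a) κ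
  | bvar {B : List (Kind Label)} {n : ℕ} {κ : Kind Label} :
      B[n]? = some κ → HasKind Δ B (.bvar n) κ
  | arrow {B : List (Kind Label)} {t₁ t₂ : Ty Label} :
      HasKind Δ B t₁ .type → HasKind Δ B t₂ .type → HasKind Δ B (.arrow t₁ t₂) .type
  | record {B : List (Kind Label)} {ρ : Ty Label} {R : RowKind Label} :
      HasKind Δ B ρ (.row R) → HasKind Δ B (.record ρ) .type
  | variant {B : List (Kind Label)} {ρ : Ty Label} {R : RowKind Label} :
      HasKind Δ B ρ (.row R) → HasKind Δ B (.variant ρ) .type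
  | mu {B : List (Kind Label)} {τ : Ty Label} :
      τ.Contractive → HasKind Δ (.type :: B) τ .type → HasKind Δ B (.mu τ) .type
  | empty {B : List (Kind Label)} : HasKind Δ B .empty (.row (.pos ∅))
  | cons {B : List (Kind Label)} {l : Label} {t ρ : Ty Label} {R R' : RowKind Label} :
      HasKind Δ B ρ (.row R) → HasKind Δ B t .type → R.Ext l R' →
      HasKind Δ B (.cons l t ρ) (.row R')

/-- Well-kindedness of a type scheme in `Δ` (with `B` as in `HasKind`). -/
def Scheme.WellKinded {Label : Type u} [DecidableEq Label] (Δ : KEnv Label) :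
    List (Kind Label) → Scheme Label → Prop
  | B, .mono t => HasKind Δ B t .type
  | B, .all κ σ => Scheme.WellKinded Δ (κ :: B) σ

/-- The standing assumption of a typing judgment `Δ; Γ ⊢ e : t`: the type `t` and all types in `Γ`
are well-kinded in `Δ`. -/
structure WellKinded {Label : Type u} [DecidableEq Label] (Δ : KEnv Label) (Γ : TEnv Label)
    (t : Ty Label) : Prop where
  env : ∀ σ ∈ Γ, σ.WellKinded Δ []
  type : HasKind Δ [] t .type

/-- The type scheme instantiation relation `Δ ⊢ σ ⪯ σ'`. -/
inductive Inst {Label : Type u} [DecidableEq Label] (Δ : KEnv Label) :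
    Scheme Label → Scheme Label → Prop
  | refl (σ : Scheme Label) : Inst Δ σ σ
  | type {σ : Scheme Label} {t : Ty Label} :
      HasKind Δ [] t .type → Inst Δ (.all .type σ) (σ.inst 0 t)
  | row {σ : Scheme Label} {ρ : Ty Label} {R R' : RowKind Label} :
      HasKind Δ [] ρ (.row R') → R'.Sub R → Inst Δ (.all (.row R) σ) (σ.inst 0 ρ)
  | trans {σ₀ σ₁ σ₂ : Scheme Label} : Inst Δ σ₀ σ₁ → Inst Δ σ₁ σ₂ → Inst Δ σ₀ σ₂

/-! ### Terms -/

/-- Terms. A list `l₁ : e₁ ∣ … ∣ lₙ : eₙ` of label-term pairs with distinct labels, the order of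
which is insignificant, is a finite set `L` of labels with a function from `L` to terms. -/
inductive Term (Label : Type u) : Type u
  /-- a variable -/
  | var (n : ℕ)
  /-- `e₁ e₂` -/
  | app (e₁ e₂ : Term Label)
  /-- `λ x = e`; `e` is under one binder -/
  | lam (e : Term Label)
  /-- `let f = e₁ in e₂`; `e₂` is under one binder -/
  | letIn (e₁ e₂ : Term Label)
  /-- the fixed point combinator -/
  | fix
  /-- `l e` -/
  | label (l : Label) (e : Term Label)
  /-- `{l₁ : e₁ ∣ … ∣ lₙ : eₙ}` -/
  | record (L : Finset Label) (f : L → Term Label)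
  /-- `e.l` -/
  | access (e : Term Label) (l : Label)
  /-- `e.-l` -/
  | delete (e : Term Label) (l : Label)
  /-- `e.{l₁ : e₁ ∣ … ∣ lₙ : eₙ}` -/
  | modify (e : Term Label) (L : Finset Label) (f : L → Term Label)
  /-- `e.+{l₁ : e₁ ∣ … ∣ lₙ : eₙ}` -/
  | extend (e : Term Label) (L : Finset Label) (f : L → Term Label)
  /-- `match e with ⟨⟩` -/
  | matchVoid (e : Term Label)
  /-- `match e with ⟨{·} ⇒ e₁⟩` -/
  | matchUnit (e e₁ : Term Label)
  /-- `match e with ⟨l x₁ ⇒ e₁ ∣ x₂ ⇒ e₂⟩`; `e₁` and `e₂` are each under one binder -/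
  | matchLabel (e : Term Label) (l : Label) (e₁ e₂ : Term Label)

namespace Term

variable {Label : Type u}

/-- Lifts a renaming under a binder. -/
def liftRen (ξ : ℕ → ℕ) : ℕ → ℕ
  | 0 => 0
  | n + 1 => ξ n + 1

/-- Renaming of the free variables. -/
def rename : (ℕ → ℕ) → Term Label → Term Label
  | ξ, var n => var (ξ n)
  | ξ, app e₁ e₂ => app (e₁.rename ξ) (e₂.rename ξ)
  | ξ, lam e => lam (e.rename (liftRen ξ))
  | ξ, letIn e₁ e₂ => letIn (e₁.rename ξ) (e₂.rename (liftRen ξ))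
  | _, fix => fix
  | ξ, label l e => label l (e.rename ξ)
  | ξ, record L f => record L (fun l => (f l).rename ξ)
  | ξ, access e l => access (e.rename ξ) l
  | ξ, delete e l => delete (e.rename ξ) l
  | ξ, modify e L f => modify (e.rename ξ) L (fun l => (f l).rename ξ)
  | ξ, extend e L f => extend (e.rename ξ) L (fun l => (f l).rename ξ)
  | ξ, matchVoid e => matchVoid (e.rename ξ)
  | ξ, matchUnit e e₁ => matchUnit (e.rename ξ) (e₁.rename ξ)
  | ξ, matchLabel e l e₁ e₂ =>
      matchLabel (e.rename ξ) l (e₁.rename (liftRen ξ)) (e₂.rename (liftRen ξ))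

/-- `e` placed under one more binder. -/
def shift (e : Term Label) : Term Label := e.rename Nat.succ

/-- Lifts a substitution under a binder. -/
def liftSub (s : ℕ → Term Label) : ℕ → Term Label
  | 0 => var 0
  | n + 1 => (s n).shift

/-- Capture-avoiding simultaneous substitution. -/
def subst : (ℕ → Term Label) → Term Label → Term Label
  | s, var n => s n
  | s, app e₁ e₂ => app (e₁.subst s) (e₂.subst s)
  | s, lam e => lam (e.subst (liftSub s))
  | s, letIn e₁ e₂ => letIn (e₁.subst s) (e₂.subst (liftSub s))
  | _, fix => fix
  | s, label l e => label l (e.subst s)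
  | s, record L f => record L (fun l => (f l).subst s)
  | s, access e l => access (e.subst s) l
  | s, delete e l => delete (e.subst s) l
  | s, modify e L f => modify (e.subst s) L (fun l => (f l).subst s)
  | s, extend e L f => extend (e.subst s) L (fun l => (f l).subst s)
  | s, matchVoid e => matchVoid (e.subst s)
  | s, matchUnit e e₁ => matchUnit (e.subst s) (e₁.subst s)
  | s, matchLabel e l e₁ e₂ =>
      matchLabel (e.subst s) l (e₁.subst (liftSub s)) (e₂.subst (liftSub s))

/-- `e[x ↦ v]` for the innermost free variable `x` of `e`, the binder of which is removed. -/
def subst₀ (e v : Term Label) : Term Label :=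
  e.subst (fun n => match n with
    | 0 => v
    | n + 1 => var n)

end Term

/-! ### Typing -/

/-- The typing judgment `Δ; Γ ⊢ e : t`. Every rule carries the standing well-kindedness assumption.
The rule `conv` expresses that the order of the label-type pairs in rows is insignificant. -/
inductive HasType {Label : Type u} [DecidableEq Label] :
    KEnv Label → TEnv Label → Term Label → Ty Label → Prop
  | var {Δ : KEnv Label} {Γ : TEnv Label} {n : ℕ} {σ : Scheme Label} {t : Ty Label} :
      WellKinded Δ Γ t →
      Γ[n]? = some σ → Inst Δ σ (.mono t) →
      HasType Δ Γ (.var n) t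
  | app {Δ : KEnv Label} {Γ : TEnv Label} {f e : Term Label} {t₁ t₂ : Ty Label} :
      WellKinded Δ Γ t₂ →
      HasType Δ Γ f (.arrow t₁ t₂) → HasType Δ Γ e t₁ →
      HasType Δ Γ (.app f e) t₂
  | lam {Δ : KEnv Label} {Γ : TEnv Label} {e : Term Label} {t₁ t₂ : Ty Label} :
      WellKinded Δ Γ (.arrow t₁ t₂) →
      HasType Δ (.mono t₁ :: Γ) e t₂ →
      HasType Δ Γ (.lam e) (.arrow t₁ t₂)
  | letIn {Δ : KEnv Label} {Γ : TEnv Label} {e₁ e₂ : Term Label} {t₁ t₂ : Ty Label}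
      (as : List ℕ) (ks : ℕ → Kind Label) :
      WellKinded Δ Γ t₂ →
      as.Nodup → as.toFinset = t₁.ftv \ Γ.ftv →
      HasType (Δ.extend ks as) Γ e₁ t₁ →
      HasType Δ (.gen ks as t₁ :: Γ) e₂ t₂ →
      HasType Δ Γ (.letIn e₁ e₂) t₂
  | fix {Δ : KEnv Label} {Γ : TEnv Label} {t₁ t₂ : Ty Label} :
      WellKinded Δ Γ (.arrow (.arrow (.arrow t₁ t₂) (.arrow t₁ t₂)) (.arrow t₁ t₂)) →
      HasType Δ Γ .fix (.arrow (.arrow (.arrow t₁ t₂) (.arrow t₁ t₂)) (.arrow t₁ t₂))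
  | label {Δ : KEnv Label} {Γ : TEnv Label} {l : Label} {e : Term Label} {t ρ : Ty Label}
      {R : RowKind Label} :
      WellKinded Δ Γ (.variant (.cons l t ρ)) →
      HasType Δ Γ e t → HasKind Δ [] ρ (.row R) → R.Sub (.neg {l}) →
      HasType Δ Γ (.label l e) (.variant (.cons l t ρ))
  | unroll {Δ : KEnv Label} {Γ : TEnv Label} {e : Term Label} {τ : Ty Label} :
      WellKinded Δ Γ τ.unroll →
      HasType Δ Γ e (.mu τ) →
      HasType Δ Γ e τ.unroll
  | roll {Δ : KEnv Label} {Γ : TEnv Label} {e : Term Label} {τ : Ty Label} :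
      WellKinded Δ Γ (.mu τ) →
      HasType Δ Γ e τ.unroll →
      HasType Δ Γ e (.mu τ)
  | record {Δ : KEnv Label} {Γ : TEnv Label} {L : Finset Label} {f : L → Term Label}
      (t : L → Ty Label) :
      WellKinded Δ Γ (.record (.fields L t .empty)) →
      (∀ l, HasType Δ Γ (f l) (t l)) →
      HasType Δ Γ (.record L f) (.record (.fields L t .empty))
  | modify {Δ : KEnv Label} {Γ : TEnv Label} {e : Term Label} {L : Finset Label}
      {f : L → Term Label} {ρ : Ty Label} (t : L → Ty Label) :
      WellKinded Δ Γ (.record (.fields L t ρ)) →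
      HasType Δ Γ e (.record (.fields L t ρ)) →
      (∀ l, HasType Δ Γ (f l) (t l)) →
      HasType Δ Γ (.modify e L f) (.record (.fields L t ρ))
  | extend {Δ : KEnv Label} {Γ : TEnv Label} {e : Term Label} {L : Finset Label}
      {f : L → Term Label} {ρ : Ty Label} {R : RowKind Label} (t : L → Ty Label) :
      WellKinded Δ Γ (.record (.fields L t ρ)) →
      HasType Δ Γ e (.record ρ) → HasKind Δ [] ρ (.row R) → R.Sub (.neg L) →
      (∀ l, HasType Δ Γ (f l) (t l)) →
      HasType Δ Γ (.extend e L f) (.record (.fields L t ρ))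
  | access {Δ : KEnv Label} {Γ : TEnv Label} {e : Term Label} {l : Label} {t ρ : Ty Label} :
      WellKinded Δ Γ t →
      HasType Δ Γ e (.record (.cons l t ρ)) →
      HasType Δ Γ (.access e l) t
  | delete {Δ : KEnv Label} {Γ : TEnv Label} {e : Term Label} {l : Label} {t ρ : Ty Label} :
      WellKinded Δ Γ (.record ρ) →
      HasType Δ Γ e (.record (.cons l t ρ)) →
      HasType Δ Γ (.delete e l) (.record ρ)
  | matchVoid {Δ : KEnv Label} {Γ : TEnv Label} {e : Term Label} {t : Ty Label} :
      WellKinded Δ Γ t →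
      HasType Δ Γ e (.variant .empty) →
      HasType Δ Γ (.matchVoid e) t
  | matchUnit {Δ : KEnv Label} {Γ : TEnv Label} {e e₁ : Term Label} {t : Ty Label} :
      WellKinded Δ Γ t →
      HasType Δ Γ e (.record .empty) → HasType Δ Γ e₁ t →
      HasType Δ Γ (.matchUnit e e₁) t
  | matchLabel {Δ : KEnv Label} {Γ : TEnv Label} {e e₁ e₂ : Term Label} {l : Label}
      {t ρ t' : Ty Label} (as bs : List ℕ) (ks : ℕ → Kind Label) :
      WellKinded Δ Γ t' →
      as.Nodup → as.toFinset = t.ftv \ Γ.ftv →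
      bs.Nodup → bs.toFinset = (Ty.variant ρ).ftv \ Γ.ftv →
      HasType (Δ.extend ks (as ++ bs)) Γ e (.variant (.cons l t ρ)) →
      HasType Δ (.gen ks as t :: Γ) e₁ t' →
      HasType Δ (.gen ks bs (.variant ρ) :: Γ) e₂ t' →
      HasType Δ Γ (.matchLabel e l e₁ e₂) t'
  | conv {Δ : KEnv Label} {Γ : TEnv Label} {e : Term Label} {t t' : Ty Label} :
      WellKinded Δ Γ t' →
      HasType Δ Γ e t → t.Equiv t' →
      HasType Δ Γ e t'

/-! ### Operational semantics -/

/-- Values. -/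
inductive Value {Label : Type u} : Term Label → Prop
  | label (l : Label) {v : Term Label} : Value v → Value (.label l v)
  | record {L : Finset Label} {f : L → Term Label} : (∀ l, Value (f l)) → Value (.record L f)
  | lam (e : Term Label) : Value (.lam e)
  | fix : Value .fix

/-- Evaluation contexts. In `record L f l E` (and in `modifyField`, `extendField`) the hole is in
the field `l`, and `f` gives the other fields; `f l` is irrelevant. As the order of the fields is
insignificant, any field may be evaluated next. -/
inductive ECtx (Label : Type u) : Type u
  | hole
  | appFun (E : ECtx Label) (e : Term Label)
  | appArg (v : Term Label) (hv : Value v) (E : ECtx Label)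
  | letIn (E : ECtx Label) (e : Term Label)
  | label (l : Label) (E : ECtx Label)
  | record (L : Finset Label) (f : L → Term Label) (l : L) (E : ECtx Label)
  | access (E : ECtx Label) (l : Label)
  | delete (E : ECtx Label) (l : Label)
  | modify (E : ECtx Label) (L : Finset Label) (f : L → Term Label)
  | extend (E : ECtx Label) (L : Finset Label) (f : L → Term Label)
  | modifyField (v : Term Label) (hv : Value v) (L : Finset Label) (f : L → Term Label) (l : L)
      (E : ECtx Label)
  | extendField (v : Term Label) (hv : Value v) (L : Finset Label) (f : L → Term Label) (l : L)
      (E : ECtx Label)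
  | matchVoid (E : ECtx Label)
  | matchUnit (E : ECtx Label) (e : Term Label)
  | matchLabel (E : ECtx Label) (l : Label) (e₁ e₂ : Term Label)

/-- `E[e]`. -/
def ECtx.plug {Label : Type u} [DecidableEq Label] : ECtx Label → Term Label → Term Label
  | hole, a => a
  | appFun E e, a => .app (E.plug a) e
  | appArg v _ E, a => .app v (E.plug a)
  | letIn E e, a => .letIn (E.plug a) e
  | label l E, a => .label l (E.plug a)
  | record L f l E, a => .record L (Function.update f l (E.plug a))
  | access E l, a => .access (E.plug a) l
  | delete E l, a => .delete (E.plug a) l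
  | modify E L f, a => .modify (E.plug a) L f
  | extend E L f, a => .extend (E.plug a) L f
  | modifyField v _ L f l E, a => .modify v L (Function.update f l (E.plug a))
  | extendField v _ L f l E, a => .extend v L (Function.update f l (E.plug a))
  | matchVoid E, a => .matchVoid (E.plug a)
  | matchUnit E e, a => .matchUnit (E.plug a) e
  | matchLabel E l e₁ e₂, a => .matchLabel (E.plug a) l e₁ e₂

/-- One-step reduction `e ⇝ e'` of a redex. -/
inductive Reduces {Label : Type u} [DecidableEq Label] : Term Label → Term Label → Prop
  | app {e v : Term Label} : Value v → Reduces (.app (.lam e) v) (e.subst₀ v)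
  | letIn {v e : Term Label} : Value v → Reduces (.letIn v e) (e.subst₀ v)
  | fix {v : Term Label} : Value v →
      Reduces (.app .fix v) (.app v (.lam (.app (.app .fix v.shift) (.var 0))))
  | access {L : Finset Label} {f : L → Term Label} (l : L) : (∀ m, Value (f m)) →
      Reduces (.access (.record L f) l.1) (f l)
  | delete {L : Finset Label} {f : L → Term Label} (l : L) : (∀ m, Value (f m)) →
      Reduces (.delete (.record L f) l.1)
        (.record (L.erase l.1) (fun m => f ⟨m.1, Finset.mem_of_mem_erase m.2⟩))
  | modify {L M : Finset Label} {f : L → Term Label} {g : M → Term Label} : M ⊆ L →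
      (∀ m, Value (f m)) → (∀ m, Value (g m)) →
      Reduces (.modify (.record L f) M g)
        (.record L (fun m => if h : m.1 ∈ M then g ⟨m.1, h⟩ else f m))
  | extend {L M : Finset Label} {f : L → Term Label} {g : M → Term Label} : Disjoint L M →
      (∀ m, Value (f m)) → (∀ m, Value (g m)) →
      Reduces (.extend (.record L f) M g)
        (.record (L ∪ M) (fun m => if h : m.1 ∈ L then f ⟨m.1, h⟩
          else g ⟨m.1, (Finset.mem_union.1 m.2).resolve_left h⟩))
  | matchUnit {f : (∅ : Finset Label) → Term Label} {e : Term Label} :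
      Reduces (.matchUnit (.record ∅ f) e) e
  | matchLabel {l : Label} {v e₁ e₂ : Term Label} : Value v →
      Reduces (.matchLabel (.label l v) l e₁ e₂) (e₁.subst₀ v)
  | matchSkip {l l' : Label} {v e₁ e₂ : Term Label} : Value v → l ≠ l' →
      Reduces (.matchLabel (.label l v) l' e₁ e₂) (e₂.subst₀ (.label l v))

/-- The stepping relation `e ↣ e'`: reduction of a redex inside an evaluation context. -/
inductive Step {Label : Type u} [DecidableEq Label] : Term Label → Term Label → Prop
  | context (E : ECtx Label) {e₁ e₂ : Term Label} :
      Reduces e₁ e₂ → Step (E.plug e₁) (E.plug e₂)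

end Elevate

/-! Progress and preservation are proved together, by one induction on the derivation of a closed
term. If an immediate subterm in evaluation position is not a value, the induction hypothesis
provides a step of it at the same type, and the same typing rule is applied again. The rules
`unroll`, `roll` and `conv`, which leave the term alone, simply transport the step. Hence inversion
of typing is needed only for values, where a redex is contracted.

For values, inversion is `HasType.canonical`: up to reordering of rows, the type given by the
syntax-directed rule is the declared type with an outermost recursive type unrolled. Contractiveness
makes one unrolling enough. Row equality is inverted through functions that respect it: the head
constructor, the components, lookup and deletion of a field.

Contracting a redex rests on the substitution lemma `HasType.subst`, which substitutes types and
terms at once. Its difficulty is that `let` and `match` generalise exactly the variables of a type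
that are not free in Γ, a set that changes under substitution. The generalised variables are first
renamed to fresh ones (`exists_fresh_kSub`). After substitution more variables may become
generalisable, so the new scheme need not be the substituted one; it is at least as general, and the
lemma therefore admits more general schemes in the environment.

The lemma is stated for an abstract predicate `Supports` on the substituted terms, since it is used
twice. With variables as substituted terms it yields weakening and type instantiation of closed
terms. These show that a closed value has all instances of its generalised type (`HasScheme`), which
is the second choice of predicate and yields substitution of values for polymorphic variables. -/

namespace Elevate

universe u

section

variable {Label : Type u}

/-! ### Substitution for free type variables -/

namespace Ty

/-- Simultaneous substitution for the free type variables. -/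
def subst (θ : ℕ → Ty Label) : Ty Label → Ty Label
  | fvar a => θ a
  | bvar n => bvar n
  | arrow t₁ t₂ => arrow (subst θ t₁) (subst θ t₂)
  | record ρ => record (subst θ ρ)
  | variant ρ => variant (subst θ ρ)
  | mu τ => mu (subst θ τ)
  | empty => empty
  | cons l t ρ => cons l (subst θ t) (subst θ ρ)

/-- All dangling indices are less than `k`. -/
def LcAt : ℕ → Ty Label → Prop
  | _, fvar _ => True
  | k, bvar n => n < k
  | k, arrow t₁ t₂ => LcAt k t₁ ∧ LcAt k t₂
  | k, record ρ => LcAt k ρ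
  | k, variant ρ => LcAt k ρ
  | k, mu τ => LcAt (k + 1) τ
  | _, empty => True
  | k, cons _ t ρ => LcAt k t ∧ LcAt k ρ

theorem LcAt.mono {t : Ty Label} {j k : ℕ} (h : LcAt j t) (hjk : j ≤ k) : LcAt k t := by
  induction t generalizing j k with
  | fvar | empty => trivial
  | bvar => exact lt_of_lt_of_le h hjk
  | arrow _ _ ih₁ ih₂ | cons _ _ _ ih₁ ih₂ => exact ⟨ih₁ h.1 hjk, ih₂ h.2 hjk⟩
  | record _ ih | variant _ ih => exact ih (j := j) h hjk
  | mu _ ih => exact ih (j := j + 1) h (by omega)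

theorem LcAt.inst_eq {t : Ty Label} {k : ℕ} (h : LcAt k t) (u : Ty Label) : inst k u t = t := by
  induction t generalizing k with
  | fvar | empty => rfl
  | bvar => exact if_neg (Nat.ne_of_lt h)
  | arrow _ _ ih₁ ih₂ | cons _ _ _ ih₁ ih₂ => simp only [inst, ih₁ h.1, ih₂ h.2]
  | record _ ih | variant _ ih => simp only [inst, ih (k := k) h]
  | mu _ ih => simp only [inst, ih (k := k + 1) h]

theorem LcAt.close {t : Ty Label} {k : ℕ} (h : LcAt k t) (a : ℕ) : LcAt (k + 1) (close k a t) := by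
  induction t generalizing k with
  | fvar b =>
    simp only [Ty.close]
    split
    · exact Nat.lt_succ_self k
    · trivial
  | empty => trivial
  | bvar => exact Nat.lt_succ_of_lt h
  | arrow _ _ ih₁ ih₂ | cons _ _ _ ih₁ ih₂ => exact ⟨ih₁ h.1, ih₂ h.2⟩
  | record _ ih | variant _ ih => exact ih (k := k) h
  | mu _ ih => exact ih (k := k + 1) h

/-- The types inserted by θ have no dangling indices, so instantiation passes over them, and they
may be moved under binders without shifting. -/
theorem subst_inst {θ : ℕ → Ty Label} (hθ : ∀ a, LcAt 0 (θ a)) (k : ℕ) (u t : Ty Label) :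
    (inst k u t).subst θ = inst k (u.subst θ) (t.subst θ) := by
  induction t generalizing k with
  | fvar a => exact (((hθ a).mono (Nat.zero_le k)).inst_eq _).symm
  | empty => rfl
  | bvar n =>
    simp only [inst, subst]
    split <;> rfl
  | arrow _ _ ih₁ ih₂ | cons _ _ _ ih₁ ih₂ => simp only [inst, subst, ih₁, ih₂]
  | record _ ih | variant _ ih | mu _ ih => simp only [inst, subst, ih]

theorem subst_unroll {θ : ℕ → Ty Label} (hθ : ∀ a, LcAt 0 (θ a)) (τ : Ty Label) :
    τ.unroll.subst θ = (τ.subst θ).unroll :=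
  subst_inst hθ 0 _ _

/-- Instantiating a closed variable is substitution for it. -/
theorem inst_subst_close {θ : ℕ → Ty Label} (hθ : ∀ a, LcAt 0 (θ a)) {t : Ty Label} {k : ℕ}
    (ht : LcAt k t) (a : ℕ) (w : Ty Label) :
    inst k w ((close k a t).subst θ) = t.subst (Function.update θ a w) := by
  induction t generalizing k with
  | fvar b =>
    simp only [Ty.close]
    split
    · next h => subst h; simp [subst, inst]
    · next h =>
      simp only [subst, Function.update_of_ne h]
      exact ((hθ b).mono (Nat.zero_le k)).inst_eq _
  | empty => rfl
  | bvar n => exact if_neg (Nat.ne_of_lt ht)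
  | arrow _ _ ih₁ ih₂ | cons _ _ _ ih₁ ih₂ =>
    simp only [inst, subst, Ty.close, ih₁ ht.1, ih₂ ht.2]
  | record _ ih | variant _ ih => simp only [inst, subst, Ty.close, ih (k := k) ht]
  | mu _ ih => simp only [inst, subst, Ty.close, ih (k := k + 1) ht]

theorem subst_congr {θ θ' : ℕ → Ty Label} {t : Ty Label} (h : ∀ a ∈ t.ftv, θ a = θ' a) :
    t.subst θ = t.subst θ' := by
  induction t with
  | fvar a => exact h a (Finset.mem_singleton_self a)
  | bvar | empty => rfl
  | arrow _ _ ih₁ ih₂ | cons _ _ _ ih₁ ih₂ =>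
    simp only [subst, ih₁ fun a ha => h a (Finset.mem_union_left _ ha),
      ih₂ fun a ha => h a (Finset.mem_union_right _ ha)]
  | record _ ih | variant _ ih | mu _ ih => simp only [subst, ih h]

theorem subst_fvar (t : Ty Label) : t.subst fvar = t := by
  induction t with
  | fvar | bvar | empty => rfl
  | arrow _ _ ih₁ ih₂ | cons _ _ _ ih₁ ih₂ => simp only [subst, ih₁, ih₂]
  | record _ ih | variant _ ih | mu _ ih => simp only [subst, ih]

theorem subst_subst (θ θ' : ℕ → Ty Label) (t : Ty Label) :
    (t.subst θ).subst θ' = t.subst fun a => (θ a).subst θ' := by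
  induction t with
  | fvar | bvar | empty => rfl
  | arrow _ _ ih₁ ih₂ | cons _ _ _ ih₁ ih₂ => simp only [subst, ih₁, ih₂]
  | record _ ih | variant _ ih | mu _ ih => simp only [subst, ih]

theorem mem_ftv_subst {θ : ℕ → Ty Label} {t : Ty Label} {b : ℕ} :
    b ∈ (t.subst θ).ftv ↔ ∃ a ∈ t.ftv, b ∈ (θ a).ftv := by
  induction t with
  | fvar | bvar | empty => simp [subst, ftv]
  | arrow _ _ ih₁ ih₂ | cons _ _ _ ih₁ ih₂ =>
    simp only [subst, ftv, Finset.mem_union, ih₁, ih₂, or_and_right, exists_or]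
  | record _ ih | variant _ ih | mu _ ih => simpa only [subst, ftv] using ih

theorem Contractive.subst {τ : Ty Label} (h : Contractive τ) (θ : ℕ → Ty Label) :
    Contractive (τ.subst θ) := by
  cases h <;> constructor

theorem LcAt.subst {θ : ℕ → Ty Label} (hθ : ∀ a, LcAt 0 (θ a)) {t : Ty Label} {k : ℕ}
    (h : LcAt k t) : LcAt k (t.subst θ) := by
  induction t generalizing k with
  | fvar a => exact (hθ a).mono (Nat.zero_le k)
  | empty => trivial
  | bvar => exact h
  | arrow _ _ ih₁ ih₂ | cons _ _ _ ih₁ ih₂ => exact ⟨ih₁ h.1, ih₂ h.2⟩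
  | record _ ih | variant _ ih => exact ih (k := k) h
  | mu _ ih => exact ih (k := k + 1) h

theorem subst_fields (θ : ℕ → Ty Label) (L : Finset Label) (t : L → Ty Label) (ρ : Ty Label) :
    (fields L t ρ).subst θ = fields L (fun l => (t l).subst θ) (ρ.subst θ) := by
  unfold fields
  induction L.attach.toList with
  | nil => rfl
  | cons l ls ih => simp only [List.foldr_cons, subst, ih]

theorem Equiv.subst {t t' : Ty Label} (h : Equiv t t') (θ : ℕ → Ty Label) :
    Equiv (t.subst θ) (t'.subst θ) := by
  induction h with
  | refl => exact .refl _
  | symm _ ih => exact ih.symm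
  | trans _ _ ih₁ ih₂ => exact ih₁.trans ih₂
  | swap _ _ _ h => exact .swap _ _ _ h
  | arrow _ _ ih₁ ih₂ => exact .arrow ih₁ ih₂
  | record _ ih => exact .record ih
  | variant _ ih => exact .variant ih
  | mu _ ih => exact .mu ih
  | cons l _ _ ih₁ ih₂ => exact .cons l ih₁ ih₂

end Ty

/-! ### Substitution for free type variables in schemes -/

namespace Scheme

/-- Simultaneous substitution for the free type variables. -/
def subst (θ : ℕ → Ty Label) : Scheme Label → Scheme Label
  | mono t => mono (t.subst θ)
  | all κ σ => all κ (subst θ σ)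

/-- All dangling indices are less than `k`. -/
def LcAt : ℕ → Scheme Label → Prop
  | k, mono t => t.LcAt k
  | k, all _ σ => LcAt (k + 1) σ

theorem LcAt.close {σ : Scheme Label} {k : ℕ} (h : LcAt k σ) (a : ℕ) :
    LcAt (k + 1) (close k a σ) := by
  induction σ generalizing k with
  | mono t => exact Ty.LcAt.close h a
  | all _ _ ih => exact ih (k := k + 1) h

theorem lcAt_gen (ks : ℕ → Kind Label) (as : List ℕ) {t : Ty Label} (h : t.LcAt 0) :
    LcAt 0 (gen ks as t) := by
  induction as with
  | nil => exact h
  | cons a as ih => exact LcAt.close ih a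

theorem subst_inst {θ : ℕ → Ty Label} (hθ : ∀ a, (θ a).LcAt 0) (k : ℕ) (u : Ty Label)
    (σ : Scheme Label) : (inst k u σ).subst θ = inst k (u.subst θ) (σ.subst θ) := by
  induction σ generalizing k with
  | mono t => simp only [inst, subst, Ty.subst_inst hθ]
  | all _ _ ih => simp only [inst, subst, ih]

/-- Instantiating a closed variable is substitution for it. -/
theorem inst_subst_close {θ : ℕ → Ty Label} (hθ : ∀ a, (θ a).LcAt 0) {σ : Scheme Label} {k : ℕ}
    (h : LcAt k σ) (a : ℕ) (w : Ty Label) :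
    inst k w ((close k a σ).subst θ) = σ.subst (Function.update θ a w) := by
  induction σ generalizing k with
  | mono t => simp only [inst, subst, close, Ty.inst_subst_close hθ (t := t) h]
  | all _ _ ih => simp only [inst, subst, close, ih (k := k + 1) h]

theorem subst_congr {θ θ' : ℕ → Ty Label} {σ : Scheme Label} (h : ∀ a ∈ σ.ftv, θ a = θ' a) :
    σ.subst θ = σ.subst θ' := by
  induction σ with
  | mono t => simp only [subst, Ty.subst_congr h]
  | all _ _ ih => simp only [subst, ih h]

theorem subst_fvar (σ : Scheme Label) : σ.subst Ty.fvar = σ := by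
  induction σ with
  | mono t => simp only [subst, Ty.subst_fvar]
  | all _ _ ih => simp only [subst, ih]

end Scheme

/-! ### Free variables and lookup in environments -/

theorem TEnv.mem_ftv {Γ : TEnv Label} {a : ℕ} : a ∈ Γ.ftv ↔ ∃ σ ∈ Γ, a ∈ σ.ftv := by
  induction Γ with
  | nil => simp [TEnv.ftv]
  | cons σ Γ ih => simp [TEnv.ftv, ih]

theorem KEnv.lookup_cons (Δ : KEnv Label) (a b : ℕ) (κ : Kind Label) :
    List.lookup a ((b, κ) :: Δ : KEnv Label) = if a = b then some κ else List.lookup a Δ := by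
  rw [List.lookup_cons]
  by_cases h : a = b
  · simp [h]
  · simp [h, beq_eq_false_iff_ne.2 h]

theorem KEnv.lookup_extend (Δ : KEnv Label) (ks : ℕ → Kind Label) (as : List ℕ) (a : ℕ) :
    List.lookup a (Δ.extend ks as) = if a ∈ as then some (ks a) else List.lookup a Δ := by
  induction as with
  | nil => rfl
  | cons b as ih =>
    change List.lookup a ((b, ks b) :: KEnv.extend Δ ks as) = _
    rw [KEnv.lookup_cons, ih]
    by_cases h : a = b
    · simp [h]
    · simp [h]

/-! ### Subkinding -/

theorem RowKind.Sub.refl (R : RowKind Label) : R.Sub R := by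
  cases R
  · exact .pp (Finset.Subset.refl _)
  · exact .nn (Finset.Subset.refl _)

theorem RowKind.Sub.trans {R R' R'' : RowKind Label} (h : R.Sub R') (h' : R'.Sub R'') :
    R.Sub R'' := by
  cases h with
  | pp h =>
    cases h' with
    | pp h' => exact .pp (h.trans h')
    | pn h' => exact .pn (Finset.disjoint_of_subset_left h h')
  | nn h =>
    cases h' with
    | nn h' => exact .nn (h'.trans h)
  | pn h =>
    cases h' with
    | nn h' => exact .pn (Finset.disjoint_of_subset_right h' h)

/-- The subkind relation. -/
inductive Kind.Le : Kind Label → Kind Label → Prop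
  | type : Le .type .type
  | row {R R' : RowKind Label} : R.Sub R' → Le (.row R) (.row R')

theorem Kind.Le.refl (κ : Kind Label) : κ.Le κ := by
  cases κ
  · exact .type
  · exact .row (.refl _)

theorem Kind.Le.trans {κ κ' κ'' : Kind Label} (h : κ.Le κ') (h' : κ'.Le κ'') : κ.Le κ'' := by
  cases h with
  | type => exact h'
  | row h =>
    cases h' with
    | row h' => exact .row (h.trans h')

variable [DecidableEq Label]

/-- A subkind admits no more labels than the kind above it, so a label that can be added to the
larger kind can be added to the smaller one. This lets a row variable under further fields be
replaced by a row of a subkind. -/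
theorem RowKind.Ext.of_sub {R R₀ R₁ : RowKind Label} {l : Label} (h : R.Ext l R₁)
    (hs : R₀.Sub R) : ∃ R₂, R₀.Ext l R₂ ∧ R₂.Sub R₁ := by
  cases h with
  | pos hl =>
    cases hs with
    | pp hs => exact ⟨_, .pos fun h => hl (hs h), .pp (Finset.insert_subset_insert _ hs)⟩
  | neg hl =>
    cases hs with
    | nn hs => exact ⟨_, .neg (hs hl), .nn (Finset.erase_subset_erase _ hs)⟩
    | pn hs =>
      refine ⟨_, .pos fun h => Finset.disjoint_left.1 hs h hl, .pn ?_⟩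
      rw [Finset.disjoint_left] at hs ⊢
      intro m hm hm'
      rw [Finset.mem_erase] at hm'
      exact hs ((Finset.mem_insert.1 hm).resolve_left hm'.1) hm'.2

theorem RowKind.Ext.sub_neg {R R' : RowKind Label} {l : Label} (h : R.Ext l R') :
    R.Sub (.neg {l}) := by
  cases h with
  | pos h => exact .pn (Finset.disjoint_singleton_right.2 h)
  | neg h => exact .nn (Finset.singleton_subset_iff.2 h)

/-- `t` has a subkind of `κ`. -/
def HasKindLe (Δ : KEnv Label) (B : List (Kind Label)) (t : Ty Label) (κ : Kind Label) : Prop :=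
  ∃ κ', HasKind Δ B t κ' ∧ κ'.Le κ

theorem HasKind.le {Δ : KEnv Label} {B : List (Kind Label)} {t : Ty Label} {κ : Kind Label}
    (h : HasKind Δ B t κ) : HasKindLe Δ B t κ :=
  ⟨κ, h, .refl κ⟩

theorem HasKindLe.type {Δ : KEnv Label} {B : List (Kind Label)} {t : Ty Label}
    (h : HasKindLe Δ B t .type) : HasKind Δ B t .type := by
  obtain ⟨κ, h, ⟨⟩⟩ := h
  exact h

theorem HasKindLe.row {Δ : KEnv Label} {B : List (Kind Label)} {t : Ty Label} {R : RowKind Label}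
    (h : HasKindLe Δ B t (.row R)) : ∃ R', HasKind Δ B t (.row R') ∧ R'.Sub R := by
  obtain ⟨κ, h, ⟨⟩⟩ := h
  exact ⟨_, h, ‹_›⟩

/-- Every kind is inhabited by a closed type or row. -/
theorem exists_hasKindLe (κ : Kind Label) :
    ∃ t : Ty Label, t.LcAt 0 ∧ ∀ Δ : KEnv Label, HasKindLe Δ [] t κ := by
  rcases κ with _ | (L | L)
  · exact ⟨.record .empty, trivial, fun Δ => (HasKind.record .empty).le⟩
  · exact ⟨.empty, trivial, fun Δ => ⟨_, .empty, .row (.pp (Finset.empty_subset _))⟩⟩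
  · exact ⟨.empty, trivial, fun Δ => ⟨_, .empty, .row (.pn (Finset.disjoint_empty_left _))⟩⟩

/-! ### Kinding -/

theorem HasKind.lcAt {Δ : KEnv Label} {B : List (Kind Label)} {t : Ty Label} {κ : Kind Label}
    (h : HasKind Δ B t κ) : t.LcAt B.length := by
  induction h with
  | fvar | empty => trivial
  | bvar h => exact (List.getElem?_eq_some_iff.1 h).1
  | arrow _ _ ih₁ ih₂ => exact ⟨ih₁, ih₂⟩
  | record _ ih | variant _ ih | mu _ _ ih => exact ih
  | cons _ _ _ ih₁ ih₂ => exact ⟨ih₂, ih₁⟩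

theorem HasKind.append {Δ : KEnv Label} {B : List (Kind Label)} {t : Ty Label} {κ : Kind Label}
    (h : HasKind Δ B t κ) (B' : List (Kind Label)) : HasKind Δ (B ++ B') t κ := by
  induction h with
  | fvar h => exact .fvar h
  | empty => exact .empty
  | bvar h =>
    have := (List.getElem?_eq_some_iff.1 h).1
    exact .bvar (by rw [List.getElem?_append_left this, h])
  | arrow _ _ ih₁ ih₂ => exact .arrow ih₁ ih₂
  | record _ ih => exact .record ih
  | variant _ ih => exact .variant ih
  | mu hc _ ih => exact .mu hc ih
  | cons _ _ hR ih₁ ih₂ => exact .cons ih₁ ih₂ hR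

/-- `Δ'` agrees with `Δ` on the variables bound in `Δ`. -/
def KEnv.Le (Δ Δ' : KEnv Label) : Prop :=
  ∀ a κ, List.lookup a Δ = some κ → List.lookup a Δ' = some κ

/-- The substitution `θ` maps the variables in `Δ` to types over `Δ'` of the proper kinds. -/
structure KSub (θ : ℕ → Ty Label) (Δ Δ' : KEnv Label) : Prop where
  lcAt : ∀ a, (θ a).LcAt 0
  kind : ∀ a κ, List.lookup a Δ = some κ → HasKindLe Δ' [] (θ a) κ

theorem KEnv.Le.kSub {Δ Δ' : KEnv Label} (h : Δ.Le Δ') : KSub Ty.fvar Δ Δ' :=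
  ⟨fun _ => trivial, fun a κ ha => (HasKind.fvar (h a κ ha)).le⟩

/-- A row variable may be replaced by a row of a smaller kind, so kinds survive only up to
subkinding. The loss does not reach ordinary types: records and variants hide the kind of their row,
and the kind of types has no proper subkind. -/
theorem HasKind.subst {Δ Δ' : KEnv Label} {θ : ℕ → Ty Label} (hθ : KSub θ Δ Δ')
    {B : List (Kind Label)} {t : Ty Label} {κ : Kind Label} (h : HasKind Δ B t κ) :
    HasKindLe Δ' B (t.subst θ) κ := by
  induction h with
  | @fvar B a κ h =>
    obtain ⟨κ', h', hle⟩ := hθ.kind a κ h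
    exact ⟨κ', h'.append B, hle⟩
  | empty => exact HasKind.empty.le
  | bvar h => exact (HasKind.bvar h).le
  | arrow _ _ ih₁ ih₂ => exact (HasKind.arrow ih₁.type ih₂.type).le
  | record _ ih =>
    obtain ⟨_, h, _⟩ := ih.row
    exact (HasKind.record h).le
  | variant _ ih =>
    obtain ⟨_, h, _⟩ := ih.row
    exact (HasKind.variant h).le
  | mu hc _ ih => exact (HasKind.mu (hc.subst θ) ih.type).le
  | cons _ _ hR ih₁ ih₂ =>
    obtain ⟨_, h, hs⟩ := ih₁.row
    obtain ⟨_, hR', hs'⟩ := hR.of_sub hs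
    exact ⟨_, .cons h ih₂.type hR', .row hs'⟩

theorem HasKind.mono {Δ Δ' : KEnv Label} (hΔ : Δ.Le Δ') {B : List (Kind Label)} {t : Ty Label}
    {κ : Kind Label} (h : HasKind Δ B t κ) : HasKind Δ' B t κ := by
  induction h with
  | fvar h => exact .fvar (hΔ _ _ h)
  | empty => exact .empty
  | bvar h => exact .bvar h
  | arrow _ _ ih₁ ih₂ => exact .arrow ih₁ ih₂
  | record _ ih => exact .record ih
  | variant _ ih => exact .variant ih
  | mu hc _ ih => exact .mu hc ih
  | cons _ _ hR ih₁ ih₂ => exact .cons ih₁ ih₂ hR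

theorem HasKindLe.mono {Δ Δ' : KEnv Label} (hΔ : Δ.Le Δ') {B : List (Kind Label)} {t : Ty Label}
    {κ : Kind Label} (h : HasKindLe Δ B t κ) : HasKindLe Δ' B t κ := by
  obtain ⟨κ', h, hle⟩ := h
  exact ⟨κ', h.mono hΔ, hle⟩

theorem HasKind.congr_env {Δ Δ' : KEnv Label} {B : List (Kind Label)} {t : Ty Label}
    {κ : Kind Label} (h : HasKind Δ B t κ)
    (hΔ : ∀ a ∈ t.ftv, List.lookup a Δ = List.lookup a Δ') : HasKind Δ' B t κ := by
  induction h with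
  | fvar h => exact .fvar (hΔ _ (Finset.mem_singleton_self _) ▸ h)
  | empty => exact .empty
  | bvar h => exact .bvar h
  | arrow _ _ ih₁ ih₂ =>
    exact .arrow (ih₁ fun a ha => hΔ a (Finset.mem_union_left _ ha))
      (ih₂ fun a ha => hΔ a (Finset.mem_union_right _ ha))
  | record _ ih => exact .record (ih hΔ)
  | variant _ ih => exact .variant (ih hΔ)
  | mu hc _ ih => exact .mu hc (ih hΔ)
  | cons _ _ hR ih₁ ih₂ =>
    exact .cons (ih₁ fun a ha => hΔ a (Finset.mem_union_right _ ha))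
      (ih₂ fun a ha => hΔ a (Finset.mem_union_left _ ha)) hR

theorem HasKind.exists_lookup {Δ : KEnv Label} {B : List (Kind Label)} {t : Ty Label}
    {κ : Kind Label} (h : HasKind Δ B t κ) {a : ℕ} (ha : a ∈ t.ftv) :
    ∃ κ', List.lookup a Δ = some κ' := by
  induction h with
  | fvar h =>
    rw [Ty.ftv, Finset.mem_singleton] at ha
    exact ⟨_, ha ▸ h⟩
  | empty | bvar => simp [Ty.ftv] at ha
  | arrow _ _ ih₁ ih₂ => exact (Finset.mem_union.1 ha).elim ih₁ ih₂
  | record _ ih | variant _ ih | mu _ _ ih => exact ih ha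
  | cons _ _ hR ih₁ ih₂ => exact (Finset.mem_union.1 ha).elim ih₂ ih₁

/-- The closed variable becomes the outermost bound one, so its kind goes to the far end of `B`. -/
theorem HasKind.close {Δ : KEnv Label} {a : ℕ} {κ₀ : Kind Label} {B : List (Kind Label)}
    {t : Ty Label} {κ : Kind Label} (h : HasKind ((a, κ₀) :: Δ) B t κ) :
    HasKind Δ (B ++ [κ₀]) (t.close B.length a) κ := by
  induction h with
  | @fvar B b κ h =>
    simp only [Ty.close]
    split
    · next hb =>
      subst hb
      simp only [List.lookup_cons_self, Option.some.injEq] at h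
      subst h
      exact .bvar (by simp)
    · next hb =>
      refine .fvar ?_
      rw [KEnv.lookup_cons] at h
      simpa [hb] using h
  | empty => exact .empty
  | bvar h => exact (HasKind.bvar h).append _
  | arrow _ _ ih₁ ih₂ => exact .arrow ih₁ ih₂
  | record _ ih => exact .record ih
  | variant _ ih => exact .variant ih
  | mu hc _ ih =>
    refine .mu ?_ ih
    cases hc <;> constructor
  | cons _ _ hR ih₁ ih₂ => exact .cons ih₁ ih₂ hR

/-! ### Well-kindedness of schemes -/

namespace Scheme

theorem WellKinded.close {Δ : KEnv Label} {a : ℕ} {κ₀ : Kind Label} {B : List (Kind Label)}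
    {σ : Scheme Label} (h : WellKinded ((a, κ₀) :: Δ) B σ) :
    WellKinded Δ (B ++ [κ₀]) (σ.close B.length a) := by
  induction σ generalizing B with
  | mono t => exact HasKind.close h
  | all κ σ ih => exact ih (B := κ :: B) h

theorem WellKinded.subst {Δ Δ' : KEnv Label} {θ : ℕ → Ty Label} (hθ : KSub θ Δ Δ')
    {B : List (Kind Label)} {σ : Scheme Label} (h : WellKinded Δ B σ) :
    WellKinded Δ' B (σ.subst θ) := by
  induction σ generalizing B with
  | mono t => exact (HasKind.subst hθ h).type
  | all κ σ ih => exact ih (B := κ :: B) h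

theorem WellKinded.mono_env {Δ Δ' : KEnv Label} (hΔ : Δ.Le Δ') {B : List (Kind Label)}
    {σ : Scheme Label} (h : WellKinded Δ B σ) : WellKinded Δ' B σ := by
  simpa only [subst_fvar] using h.subst hΔ.kSub

theorem WellKinded.exists_lookup {Δ : KEnv Label} {B : List (Kind Label)} {σ : Scheme Label}
    (h : WellKinded Δ B σ) {a : ℕ} (ha : a ∈ σ.ftv) : ∃ κ, List.lookup a Δ = some κ := by
  induction σ generalizing B with
  | mono t => exact HasKind.exists_lookup h ha
  | all κ σ ih => exact ih (B := κ :: B) h ha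

end Scheme

theorem wellKinded_gen {Δ : KEnv Label} {ks : ℕ → Kind Label} {as : List ℕ} {t : Ty Label}
    (h : HasKind (Δ.extend ks as) [] t .type) : (Scheme.gen ks as t).WellKinded Δ [] := by
  have key : ∀ (as : List ℕ) (Δ : KEnv Label),
      HasKind (Δ.extend ks as) [] t .type → (Scheme.gen ks as t).WellKinded Δ [] := by
    intro as
    induction as with
    | nil => exact fun Δ h => h
    | cons a as ih =>
      intro Δ h
      -- Closing removes `a` last, so its binding has to lie below those of `as`. Moving it there
      -- changes no lookup, since a repeated name has the same kind `ks a` in both places.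
      refine Scheme.WellKinded.close (B := []) (ih ((a, ks a) :: Δ) (h.mono ?_))
      intro b κ hb
      rw [KEnv.lookup_extend] at hb ⊢
      by_cases h₁ : b ∈ as
      · simpa [h₁] using hb
      · by_cases h₂ : b = a
        · subst h₂
          simpa [h₁] using hb
        · simpa [h₁, h₂, KEnv.lookup_cons] using hb
  exact key as Δ h

/-! ### Instantiation -/

/-- `InstTo Δ σ t`: the scheme `σ` has the instance `t`. -/
inductive InstTo (Δ : KEnv Label) : Scheme Label → Ty Label → Prop
  | mono (t : Ty Label) : InstTo Δ (.mono t) t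
  | all {κ : Kind Label} {σ : Scheme Label} {w t : Ty Label} :
      HasKindLe Δ [] w κ → InstTo Δ (σ.inst 0 w) t → InstTo Δ (.all κ σ) t

/-- Strips the quantifiers from the outside one by one, which removes reflexivity and transitivity
and makes instances of a quantified scheme invertible. -/
theorem inst_mono_iff {Δ : KEnv Label} {σ : Scheme Label} {t : Ty Label} :
    Inst Δ σ (.mono t) ↔ InstTo Δ σ t := by
  constructor
  · have key : ∀ σ', Inst Δ σ σ' → InstTo Δ σ' t → InstTo Δ σ t := by
      intro σ' h
      induction h with
      | refl => exact id
      | type h => exact fun h' => .all h.le h'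
      | row h hs => exact fun h' => .all ⟨_, h, .row hs⟩ h'
      | trans _ _ ih₁ ih₂ => exact fun h' => ih₁ (ih₂ h')
    exact fun h => key _ h (.mono t)
  · intro h
    induction h with
    | mono => exact .refl _
    | @all κ _ _ _ h _ ih =>
      cases κ with
      | type => exact .trans (.type h.type) ih
      | row R =>
        obtain ⟨_, h, hs⟩ := h.row
        exact .trans (.row h hs) ih

theorem InstTo.subst {Δ Δ' : KEnv Label} {θ : ℕ → Ty Label} (hθ : KSub θ Δ Δ')
    {σ : Scheme Label} {t : Ty Label} (h : InstTo Δ σ t) :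
    InstTo Δ' (σ.subst θ) (t.subst θ) := by
  induction h with
  | mono => exact .mono _
  | all h _ ih =>
    rw [Scheme.subst_inst hθ.lcAt] at ih
    obtain ⟨κ', h, hle⟩ := h
    obtain ⟨κ'', h, hle'⟩ := h.subst hθ
    exact .all ⟨κ'', h, hle'.trans hle⟩ ih

/-- The instances of a generalised type. -/
theorem instTo_subst_gen {Δ : KEnv Label} {ks : ℕ → Kind Label} {as : List ℕ} {t u : Ty Label}
    (ht : t.LcAt 0) {θ : ℕ → Ty Label} (hθ : ∀ a, (θ a).LcAt 0) (has : as.Nodup) :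
    InstTo Δ ((Scheme.gen ks as t).subst θ) u ↔ ∃ φ : ℕ → Ty Label,
      (∀ a ∈ as, HasKindLe Δ [] (φ a) (ks a)) ∧ u = t.subst fun a => if a ∈ as then φ a else θ a := by
  induction as generalizing θ with
  | nil =>
    constructor
    · rintro ⟨⟩
      exact ⟨Ty.fvar, by simp, by simp⟩
    · rintro ⟨_, _, rfl⟩
      exact .mono _
  | cons a as ih =>
    have lcw : ∀ {w : Ty Label} {κ}, HasKindLe Δ [] w κ → ∀ b, (Function.update θ a w b).LcAt 0 := by
      rintro w κ ⟨_, hw, _⟩ b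
      by_cases hb : b = a
      · subst hb; simpa using hw.lcAt
      · simpa [hb] using hθ b
    rw [List.nodup_cons] at has
    constructor
    · rintro (_ | ⟨hw, h⟩)
      rename_i w
      -- Instantiating the outermost quantifier by `w` amounts to updating θ at `a`. As `a` is not
      -- repeated in `as`, the inner quantifiers do not override this value.
      rw [Scheme.inst_subst_close hθ (Scheme.lcAt_gen ks as ht), ih (lcw hw) has.2] at h
      obtain ⟨φ, hφ, rfl⟩ := h
      refine ⟨fun b => if b = a then w else φ b, ?_, ?_⟩
      · intro b hb
        by_cases hba : b = a
        · subst hba; simpa using hw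
        · simpa [hba] using hφ b ((List.mem_cons.1 hb).resolve_left hba)
      · refine Ty.subst_congr fun b _ => ?_
        by_cases hba : b = a
        · subst hba; simp [has.1]
        · simp [hba]
    · rintro ⟨φ, hφ, rfl⟩
      have hw := hφ a List.mem_cons_self
      refine .all hw ?_
      rw [Scheme.inst_subst_close hθ (Scheme.lcAt_gen ks as ht), ih (lcw hw) has.2]
      refine ⟨φ, fun b hb => hφ b (List.mem_cons_of_mem _ hb), Ty.subst_congr fun b _ => ?_⟩
      by_cases hba : b = a
      · subst hba; simp
      · simp [hba]

end

section

variable {Label : Type u}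

/-! ### Renaming of term variables -/

namespace Term

theorem liftRen_comp (ξ ξ' : ℕ → ℕ) : liftRen ξ' ∘ liftRen ξ = liftRen (ξ' ∘ ξ) := by
  funext n
  cases n <;> rfl

theorem liftRen_id : liftRen id = id := by
  funext n
  cases n <;> rfl

theorem rename_rename (e : Term Label) (ξ ξ' : ℕ → ℕ) :
    (e.rename ξ).rename ξ' = e.rename (ξ' ∘ ξ) := by
  induction e generalizing ξ ξ' <;> simp_all [rename, liftRen_comp]

theorem rename_id (e : Term Label) : e.rename id = e := by
  induction e <;> simp_all [rename, liftRen_id]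

theorem liftSub_var (ξ : ℕ → ℕ) :
    liftSub (fun n => var (ξ n)) = fun n => (var (liftRen ξ n) : Term Label) := by
  funext n
  cases n <;> rfl

theorem subst_var (e : Term Label) (ξ : ℕ → ℕ) : (e.subst fun n => var (ξ n)) = e.rename ξ := by
  induction e generalizing ξ <;> simp_all [rename, subst, liftSub_var]

end Term

/-- With such a bound `N`, the names `N + a` are fresh copies of the names `a`, and old and fresh
names are told apart by comparison with `N`. -/
theorem KEnv.exists_fresh (Δ : KEnv Label) :
    ∃ N : ℕ, ∀ a κ, List.lookup a Δ = some κ → a < N := by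
  induction Δ with
  | nil => exact ⟨0, by simp⟩
  | cons p Δ ih =>
    obtain ⟨N, hN⟩ := ih
    obtain ⟨b, κ₀⟩ := p
    refine ⟨max N (b + 1), fun a κ h => ?_⟩
    rw [KEnv.lookup_cons] at h
    split at h
    · omega
    · exact lt_of_lt_of_le (hN a κ h) (le_max_left _ _)

variable [DecidableEq Label]

/-! ### The substitution lemma -/

theorem HasType.wellKinded {Δ : KEnv Label} {Γ : TEnv Label} {e : Term Label} {t : Ty Label}
    (h : HasType Δ Γ e t) : WellKinded Δ Γ t := by
  cases h <;> assumption

/-- `σ'` has all the instances of `σ`, also over larger environments. -/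
def MoreGeneral (Δ : KEnv Label) (σ' σ : Scheme Label) : Prop :=
  ∀ Δ', Δ.Le Δ' → ∀ t, InstTo Δ' σ t → InstTo Δ' σ' t

/-- `P Δ Γ e σ` is a sufficient condition for `e` to be substituted for a variable of type scheme
`σ`. -/
structure Supports (P : KEnv Label → TEnv Label → Term Label → Scheme Label → Prop) : Prop where
  hasType : ∀ {Δ Γ e σ t}, P Δ Γ e σ → WellKinded Δ Γ t → InstTo Δ σ t → HasType Δ Γ e t
  mono : ∀ {Δ Δ' Γ e σ}, Δ.Le Δ' → P Δ Γ e σ → P Δ' Γ e σ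
  shift : ∀ {Δ Γ e σ} (σ'), P Δ Γ e σ → P Δ (σ' :: Γ) e.shift σ
  head : ∀ {Δ Γ σ σ'}, MoreGeneral Δ σ' σ → P Δ (σ' :: Γ) (.var 0) σ

theorem MoreGeneral.refl (Δ : KEnv Label) (σ : Scheme Label) : MoreGeneral Δ σ σ :=
  fun _ _ _ => id

/-- Going under a binder may put a scheme in the new environment that is more general than the
substituted one. The `let` and `match` cases need this slack. -/
theorem Supports.liftSub {P : KEnv Label → TEnv Label → Term Label → Scheme Label → Prop}
    (hP : Supports P) {Δ : KEnv Label} {Γ Γ' : TEnv Label} {θ : ℕ → Ty Label}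
    {s : ℕ → Term Label} {σ σ' : Scheme Label}
    (h : ∀ n σ, Γ[n]? = some σ → P Δ Γ' (s n) (σ.subst θ))
    (hσ : MoreGeneral Δ σ' (σ.subst θ)) (n : ℕ) (σ₁ : Scheme Label)
    (hn : (σ :: Γ)[n]? = some σ₁) : P Δ (σ' :: Γ') (Term.liftSub s n) (σ₁.subst θ) := by
  cases n with
  | zero =>
    obtain rfl : σ = σ₁ := by simpa using hn
    exact hP.head hσ
  | succ n => exact hP.shift _ (h n σ₁ (by simpa using hn))

theorem WellKinded.exists_lookup {Δ : KEnv Label} {Γ : TEnv Label}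
    (hΓ : ∀ σ ∈ Γ, σ.WellKinded Δ []) {a : ℕ} (ha : a ∈ Γ.ftv) :
    ∃ κ, List.lookup a Δ = some κ := by
  obtain ⟨σ, hσ, ha⟩ := TEnv.mem_ftv.1 ha
  exact (hΓ σ hσ).exists_lookup ha

/-- Renaming of the variables in `cs` to fresh ones, for the substitution in a generalised type:
for the types `t` over `Δ, cs`, the variables of `t` that are not free in `Γ` may be generalised
after the substitution as well. -/
theorem exists_fresh_kSub {Δ Δ' : KEnv Label} {Γ Γ' : TEnv Label} {θ : ℕ → Ty Label}
    (hθ : KSub θ Δ Δ') (hΓ' : ∀ σ ∈ Γ', σ.WellKinded Δ' []) (ks : ℕ → Kind Label)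
    (cs : List ℕ) (hcs : ∀ a ∈ cs, a ∉ Γ.ftv) :
    ∃ (θ' : ℕ → Ty Label) (ks' : ℕ → Kind Label),
      (∀ a, a ∉ cs → θ' a = θ a) ∧
      (∀ cs' : List ℕ, Δ'.Le (Δ'.extend ks' cs')) ∧
      (∀ cs' : List ℕ, (∀ a ∈ cs, ∀ b ∈ (θ' a).ftv, b ∉ Γ'.ftv → b ∈ cs') →
        KSub θ' (Δ.extend ks cs) (Δ'.extend ks' cs')) ∧
      ∀ (t : Ty Label) (as as' : List ℕ), HasKind (Δ.extend ks cs) [] t .type →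
        as.Nodup → as ⊆ cs → as.toFinset = t.ftv \ Γ.ftv →
        as'.Nodup → as'.toFinset = (t.subst θ').ftv \ Γ'.ftv →
        MoreGeneral Δ' (.gen ks' as' (t.subst θ')) ((Scheme.gen ks as t).subst θ) := by
  obtain ⟨N, hN⟩ := Δ'.exists_fresh
  have hθN : ∀ a κ, List.lookup a Δ = some κ → ∀ b ∈ (θ a).ftv,
      ∃ κ', List.lookup b Δ' = some κ' := by
    intro a κ ha b hb
    obtain ⟨κ', h, _⟩ := hθ.kind a κ ha
    exact h.exists_lookup hb
  have hlc : ∀ a, (if a ∈ cs then Ty.fvar (N + a) else θ a).LcAt 0 := by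
    intro a
    split
    · trivial
    · exact hθ.lcAt a
  -- Fresh names inherit the kind of their original and old names keep their kind in `Δ'`, so
  -- rebinding any of them preserves the existing bindings. The default kind only serves names
  -- unbound in `Δ'`.
  have hle : ∀ cs' : List ℕ, Δ'.Le (Δ'.extend (fun b =>
      if N ≤ b then ks (b - N) else (List.lookup b Δ').getD .type) cs') := by
    intro cs' b κ hb
    rw [KEnv.lookup_extend]
    have := hN b κ hb
    simp [hb, Nat.not_le.2 this]
  refine ⟨fun a => if a ∈ cs then .fvar (N + a) else θ a,
    fun b => if N ≤ b then ks (b - N) else (List.lookup b Δ').getD .type,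
    fun a ha => if_neg ha, hle, fun cs' hcs' => ⟨hlc, fun a κ ha => ?_⟩, ?_⟩
  · rw [KEnv.lookup_extend] at ha
    by_cases hac : a ∈ cs
    · simp only [hac, if_true, Option.some.injEq] at ha
      subst ha
      have hmem : N + a ∈ cs' := by
        refine hcs' a hac (N + a) (by simp [hac, Ty.ftv]) fun h => ?_
        -- A fresh name cannot be free in `Γ'`, whose schemes are well-kinded in `Δ'`; hence it is
        -- generalised.
        obtain ⟨κ, hκ⟩ := WellKinded.exists_lookup hΓ' h
        have := hN _ _ hκ
        omega
      simp only [hac, if_true]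
      refine (HasKind.fvar ?_).le
      rw [KEnv.lookup_extend]
      simp [hmem]
    · simp only [hac, if_false] at ha ⊢
      exact (hθ.kind a κ ha).mono (hle cs')
  · intro t as as' ht has hac hasΓ has' hasΓ' Δ'' hΔ'' u hu
    have hmas : ∀ a, a ∈ as ↔ a ∈ t.ftv ∧ a ∉ Γ.ftv := by
      intro a; rw [← List.mem_toFinset, hasΓ, Finset.mem_sdiff]
    have hmas' : ∀ b, b ∈ as' ↔
        b ∈ (t.subst fun a => if a ∈ cs then Ty.fvar (N + a) else θ a).ftv ∧ b ∉ Γ'.ftv := by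
      intro a; rw [← List.mem_toFinset, hasΓ', Finset.mem_sdiff]
    have hdom : ∀ a ∈ t.ftv, a ∉ cs → ∃ κ, List.lookup a Δ = some κ := by
      intro a ha hc
      obtain ⟨κ, h⟩ := ht.exists_lookup ha
      rw [KEnv.lookup_extend, if_neg hc] at h
      exact ⟨κ, h⟩
    rw [instTo_subst_gen ht.lcAt hθ.lcAt has] at hu
    obtain ⟨φ, hφ, rfl⟩ := hu
    rw [← Scheme.subst_fvar (Scheme.gen _ as' _),
      instTo_subst_gen (ht.lcAt.subst hlc) (θ := Ty.fvar) (fun _ => trivial) has']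
    -- A fresh name `N + a` is instantiated as `a` was. An old name that has become generalisable is
    -- instantiated by itself, which undoes the extra generalisation.
    refine ⟨fun b => if N ≤ b then φ (b - N) else .fvar b, ?_, ?_⟩
    · intro b hb
      obtain ⟨hb, -⟩ := (hmas' b).1 hb
      obtain ⟨a, ha, hb⟩ := Ty.mem_ftv_subst.1 hb
      by_cases hc : a ∈ cs
      · simp only [hc, if_true, Ty.ftv, Finset.mem_singleton] at hb
        subst hb
        simpa using hφ a ((hmas a).2 ⟨ha, hcs a hc⟩)
      · simp only [hc, if_false] at hb
        obtain ⟨κ, h⟩ := hdom a ha hc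
        obtain ⟨κ', h'⟩ := hθN a κ h b hb
        have := hN b κ' h'
        simp only [Nat.not_le.2 this, if_false, h', Option.getD_some]
        exact (HasKind.fvar (hΔ'' _ _ h')).le
    · rw [Ty.subst_subst]
      refine Ty.subst_congr fun a ha => ?_
      by_cases hc : a ∈ cs
      · have h₁ : a ∈ as := (hmas a).2 ⟨ha, hcs a hc⟩
        have h₂ : N + a ∈ as' := by
          refine (hmas' _).2 ⟨Ty.mem_ftv_subst.2 ⟨a, ha, by simp [hc, Ty.ftv]⟩, fun h => ?_⟩
          obtain ⟨κ, hκ⟩ := WellKinded.exists_lookup hΓ' h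
          have := hN _ _ hκ
          omega
        simp [hc, h₁, h₂, Ty.subst]
      · have h₁ : a ∉ as := fun h => hc (hac h)
        simp only [hc, h₁, if_false]
        obtain ⟨κ, h⟩ := hdom a ha hc
        conv_lhs => rw [← Ty.subst_fvar (θ a)]
        refine Ty.subst_congr fun b hb => ?_
        obtain ⟨κ', h'⟩ := hθN a κ h b hb
        have := hN b κ' h'
        simp [Nat.not_le.2 this]

/-- In a `match` the scrutinee is typed with the variables of both branches added, while each scheme
binds only the variables of its own type. -/
theorem HasKind.of_extend {Δ : KEnv Label} {ks : ℕ → Kind Label} {as cs : List ℕ}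
    {t : Ty Label} {κ : Kind Label} (h : HasKind (Δ.extend ks cs) [] t κ)
    (has : ∀ a ∈ t.ftv, a ∈ cs ↔ a ∈ as) : HasKind (Δ.extend ks as) [] t κ := by
  refine h.congr_env fun a ha => ?_
  simp only [KEnv.lookup_extend, has a ha]

theorem HasKind.of_variant_cons {Δ : KEnv Label} {B : List (Kind Label)} {l : Label}
    {t ρ : Ty Label} {κ : Kind Label} (h : HasKind Δ B (.variant (.cons l t ρ)) κ) :
    HasKind Δ B t .type ∧ HasKind Δ B (.variant ρ) .type := by
  obtain _ | _ | _ | _ | ⟨_ | _ | _ | _ | _ | _ | _ | ⟨h₁, h₂, _⟩⟩ := h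
  exact ⟨h₂, .variant h₁⟩

/-- Types and values may be substituted simultaneously in a typing judgment. -/
theorem HasType.subst {P : KEnv Label → TEnv Label → Term Label → Scheme Label → Prop}
    (hP : Supports P) {Δ : KEnv Label} {Γ : TEnv Label} {e : Term Label} {t : Ty Label}
    (h : HasType Δ Γ e t) {Δ' : KEnv Label} {Γ' : TEnv Label} {θ : ℕ → Ty Label}
    {s : ℕ → Term Label} (hθ : KSub θ Δ Δ') (hΓ' : ∀ σ ∈ Γ', σ.WellKinded Δ' [])
    (hs : ∀ n σ, Γ[n]? = some σ → P Δ' Γ' (s n) (σ.subst θ)) :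
    HasType Δ' Γ' (e.subst s) (t.subst θ) := by
  have hwk : ∀ {Δ Δ' : KEnv Label} {Γ Γ' : TEnv Label} {t : Ty Label} {θ : ℕ → Ty Label},
      WellKinded Δ Γ t → KSub θ Δ Δ' → (∀ σ ∈ Γ', σ.WellKinded Δ' []) →
      WellKinded Δ' Γ' (t.subst θ) :=
    fun h hθ hΓ' => ⟨hΓ', (h.type.subst hθ).type⟩
  have hcons : ∀ {Δ : KEnv Label} {Γ : TEnv Label} {σ : Scheme Label},
      (∀ σ ∈ Γ, σ.WellKinded Δ []) → σ.WellKinded Δ [] →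
      ∀ σ' ∈ σ :: Γ, σ'.WellKinded Δ [] :=
    fun hΓ hσ σ' h => (List.mem_cons.1 h).elim (fun h => h ▸ hσ) (hΓ σ')
  induction h generalizing Δ' Γ' θ s with
  | var wk hn hi =>
    exact hP.hasType (hs _ _ hn) (hwk wk hθ hΓ') ((inst_mono_iff.1 hi).subst hθ)
  | app wk _ _ ih₁ ih₂ => exact .app (hwk wk hθ hΓ') (ih₁ hθ hΓ' hs) (ih₂ hθ hΓ' hs)
  | lam wk _ ih =>
    have wk' := hwk wk hθ hΓ'
    refine .lam wk' (ih hθ (hcons hΓ' ?_) (hP.liftSub hs (.refl _ _)))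
    cases wk'.type
    assumption
  | @letIn Δ Γ e₁ e₂ t₁ t₂ as ks wk has hasΓ h₁ _ ih₁ ih₂ =>
    have hmas : ∀ a, a ∈ as ↔ a ∈ t₁.ftv ∧ a ∉ Γ.ftv := by
      intro a; rw [← List.mem_toFinset, hasΓ, Finset.mem_sdiff]
    obtain ⟨θ', ks', hθθ', hle, hsub, hgen⟩ :=
      exists_fresh_kSub hθ hΓ' ks as fun a ha => ((hmas a).1 ha).2
    have has' : ((t₁.subst θ').ftv \ Γ'.ftv).toList.toFinset = (t₁.subst θ').ftv \ Γ'.ftv :=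
      Finset.toList_toFinset _
    have hty := ih₁ (hsub ((t₁.subst θ').ftv \ Γ'.ftv).toList fun a ha b hb hb' =>
        Finset.mem_toList.2 (Finset.mem_sdiff.2
          ⟨Ty.mem_ftv_subst.2 ⟨a, ((hmas a).1 ha).1, hb⟩, hb'⟩))
      (fun σ hσ => (hΓ' σ hσ).mono_env (hle _)) (s := s) (fun n σ hn => by
        -- Generalised variables are not free in Γ, so the renaming is invisible to its schemes.
        have : σ.subst θ' = σ.subst θ := Scheme.subst_congr fun a ha => hθθ' a fun hc =>
          ((hmas a).1 hc).2 (TEnv.mem_ftv.2 ⟨σ, List.mem_of_getElem? hn, ha⟩)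
        rw [this]
        exact hP.mono (hle _) (hs n σ hn))
    exact .letIn _ ks' (hwk wk hθ hΓ') (Finset.nodup_toList _) has' hty
      (ih₂ hθ (hcons hΓ' (wellKinded_gen hty.wellKinded.type)) (hP.liftSub hs
        (hgen t₁ as _ h₁.wellKinded.type has (List.Subset.refl _) hasΓ
          (Finset.nodup_toList _) has')))
  | fix wk => exact .fix (hwk wk hθ hΓ')
  | label wk _ hR hs' ih =>
    obtain ⟨_, h, hs''⟩ := (hR.subst hθ).row
    exact .label (hwk wk hθ hΓ') (ih hθ hΓ' hs) h (hs''.trans hs')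
  | unroll wk _ ih =>
    have wk' := hwk wk hθ hΓ'
    rw [Ty.subst_unroll hθ.lcAt] at wk' ⊢
    exact .unroll wk' (ih hθ hΓ' hs)
  | roll wk _ ih =>
    have h := ih hθ hΓ' hs
    rw [Ty.subst_unroll hθ.lcAt] at h
    exact .roll (hwk wk hθ hΓ') h
  | record t wk _ ih =>
    have wk' := hwk wk hθ hΓ'
    simp only [Ty.subst, Ty.subst_fields] at wk' ⊢
    exact .record _ wk' fun l => ih l hθ hΓ' hs
  | modify t wk _ _ ih₁ ih₂ =>
    have wk' := hwk wk hθ hΓ'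
    have h := ih₁ hθ hΓ' hs
    simp only [Ty.subst, Ty.subst_fields] at wk' h ⊢
    exact .modify _ wk' h fun l => ih₂ l hθ hΓ' hs
  | extend t wk _ hR hs' _ ih₁ ih₂ =>
    have wk' := hwk wk hθ hΓ'
    obtain ⟨_, hR', hs''⟩ := (hR.subst hθ).row
    simp only [Ty.subst, Ty.subst_fields] at wk' ⊢
    exact .extend _ wk' (ih₁ hθ hΓ' hs) hR' (hs''.trans hs') fun l => ih₂ l hθ hΓ' hs
  | access wk _ ih => exact .access (hwk wk hθ hΓ') (ih hθ hΓ' hs)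
  | delete wk _ ih => exact .delete (hwk wk hθ hΓ') (ih hθ hΓ' hs)
  | matchVoid wk _ ih => exact .matchVoid (hwk wk hθ hΓ') (ih hθ hΓ' hs)
  | matchUnit wk _ _ ih₁ ih₂ =>
    exact .matchUnit (hwk wk hθ hΓ') (ih₁ hθ hΓ' hs) (ih₂ hθ hΓ' hs)
  | @matchLabel Δ Γ e e₁ e₂ l t ρ t' as bs ks wk has hasΓ hbs hbsΓ h₁ _ _ ih ih₁ ih₂ =>
    have hmas : ∀ a, a ∈ as ↔ a ∈ t.ftv ∧ a ∉ Γ.ftv := by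
      intro a; rw [← List.mem_toFinset, hasΓ, Finset.mem_sdiff]
    have hmbs : ∀ a, a ∈ bs ↔ a ∈ (Ty.variant ρ).ftv ∧ a ∉ Γ.ftv := by
      intro a; rw [← List.mem_toFinset, hbsΓ, Finset.mem_sdiff]
    have hcs : ∀ a ∈ as ++ bs, a ∉ Γ.ftv := fun a ha =>
      (List.mem_append.1 ha).elim (fun ha => ((hmas a).1 ha).2) fun ha => ((hmbs a).1 ha).2
    obtain ⟨θ', ks', hθθ', hle, hsub, hgen⟩ :=
      exists_fresh_kSub hθ hΓ' ks (as ++ bs) hcs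
    obtain ⟨as', has', hasΓ'⟩ : ∃ as' : List ℕ, as'.Nodup ∧
        as'.toFinset = (t.subst θ').ftv \ Γ'.ftv :=
      ⟨_, Finset.nodup_toList _, Finset.toList_toFinset _⟩
    obtain ⟨bs', hbs', hbsΓ'⟩ : ∃ bs' : List ℕ, bs'.Nodup ∧
        bs'.toFinset = ((Ty.variant ρ).subst θ').ftv \ Γ'.ftv :=
      ⟨_, Finset.nodup_toList _, Finset.toList_toFinset _⟩
    have hmas' : ∀ a, a ∈ as' ↔ a ∈ (t.subst θ').ftv ∧ a ∉ Γ'.ftv := by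
      intro a; rw [← List.mem_toFinset, hasΓ', Finset.mem_sdiff]
    have hmbs' : ∀ a, a ∈ bs' ↔ a ∈ ((Ty.variant ρ).subst θ').ftv ∧ a ∉ Γ'.ftv := by
      intro a; rw [← List.mem_toFinset, hbsΓ', Finset.mem_sdiff]
    have hty := ih (hsub (as' ++ bs') fun a ha b hb hb' => by
        rw [List.mem_append] at ha ⊢
        exact ha.imp
          (fun ha => (hmas' b).2 ⟨Ty.mem_ftv_subst.2 ⟨a, ((hmas a).1 ha).1, hb⟩, hb'⟩)
          fun ha => (hmbs' b).2 ⟨Ty.mem_ftv_subst.2 ⟨a, ((hmbs a).1 ha).1, hb⟩, hb'⟩)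
      (fun σ hσ => (hΓ' σ hσ).mono_env (hle _)) (s := s) (fun n σ hn => by
        have : σ.subst θ' = σ.subst θ := Scheme.subst_congr fun a ha => hθθ' a fun hc =>
          hcs a hc (TEnv.mem_ftv.2 ⟨σ, List.mem_of_getElem? hn, ha⟩)
        rw [this]
        exact hP.mono (hle _) (hs n σ hn))
    obtain ⟨hk₁, hk₂⟩ := h₁.wellKinded.type.of_variant_cons
    obtain ⟨hk₁', hk₂'⟩ := hty.wellKinded.type.of_variant_cons
    refine .matchLabel as' bs' ks' (hwk wk hθ hΓ') has' hasΓ' hbs' hbsΓ' hty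
      (ih₁ hθ (hcons hΓ' (wellKinded_gen (hk₁'.of_extend fun a ha => ?_)))
        (hP.liftSub hs (hgen t as as' hk₁ has (List.subset_append_left _ _) hasΓ has' hasΓ')))
      (ih₂ hθ (hcons hΓ' (wellKinded_gen (hk₂'.of_extend fun a ha => ?_)))
        (hP.liftSub hs (hgen _ bs bs' hk₂ hbs (List.subset_append_right _ _) hbsΓ hbs' hbsΓ')))
    · rw [List.mem_append, hmas', hmbs']
      tauto
    · change a ∈ ((Ty.variant ρ).subst θ').ftv at ha
      rw [List.mem_append, hmas', hmbs']
      tauto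
  | conv wk _ he ih => exact .conv (hwk wk hθ hΓ') (ih hθ hΓ' hs) (he.subst θ)

/-- A variable may be substituted for a variable of a less general type scheme. -/
theorem supports_var : Supports (Label := Label) fun Δ Γ e σ =>
    ∃ n σ', e = .var n ∧ Γ[n]? = some σ' ∧ MoreGeneral Δ σ' σ where
  hasType := by
    rintro Δ Γ e σ t ⟨n, σ', rfl, hn, hσ⟩ wk hi
    exact .var wk hn (inst_mono_iff.2 (hσ Δ (fun _ _ => id) t hi))
  mono := by
    rintro Δ Δ' Γ e σ hΔ ⟨n, σ', rfl, hn, hσ⟩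
    exact ⟨n, σ', rfl, hn, fun Δ'' h => hσ Δ'' fun a κ ha => h a κ (hΔ a κ ha)⟩
  shift := by
    rintro Δ Γ e σ σ' ⟨n, σ'', rfl, hn, hσ⟩
    exact ⟨n + 1, σ'', rfl, by simpa using hn, hσ⟩
  head := fun hσ => ⟨0, _, rfl, rfl, hσ⟩

/-- A term without free variables has all the substitution instances of its type, in all
environments. -/
theorem HasType.rename_of_nil {Δ Δ' : KEnv Label} {Γ' : TEnv Label} {e : Term Label}
    {t : Ty Label} (h : HasType Δ [] e t) {θ : ℕ → Ty Label} (hθ : KSub θ Δ Δ')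
    (hΓ' : ∀ σ ∈ Γ', σ.WellKinded Δ' []) (ξ : ℕ → ℕ) :
    HasType Δ' Γ' (e.rename ξ) (t.subst θ) := by
  rw [← Term.subst_var]
  exact h.subst supports_var hθ hΓ' (by simp)

/-- `e` has all the instances of `σ`, over all larger environments. -/
def HasScheme (Δ : KEnv Label) (Γ : TEnv Label) (e : Term Label) (σ : Scheme Label) : Prop :=
  ∀ Δ' Γ' ξ, Δ.Le Δ' → (∀ n σ, Γ[n]? = some σ → Γ'[ξ n]? = some σ) →
    ∀ t, WellKinded Δ' Γ' t → InstTo Δ' σ t → HasType Δ' Γ' (e.rename ξ) t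

/-- `HasScheme` quantifies over all larger environments and compatible renamings, so monotonicity
and weakening hold by composition. -/
theorem supports_hasScheme : Supports (Label := Label) HasScheme where
  hasType := by
    intro Δ Γ e σ t h wk hi
    have := h Δ Γ id (fun _ _ => id) (fun _ _ => id) t wk hi
    rwa [Term.rename_id] at this
  mono := fun hΔ h Δ'' Γ' ξ hΔ' =>
    h Δ'' Γ' ξ fun a κ ha => hΔ' a κ (hΔ a κ ha)
  shift := by
    intro Δ Γ e σ σ' h Δ' Γ' ξ hΔ hξ t wk hi
    rw [Term.shift, Term.rename_rename]
    exact h Δ' Γ' _ hΔ (fun n σ hn => hξ (n + 1) σ (by simpa using hn)) t wk hi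
  head := fun hσ Δ' _ _ hΔ hξ t wk hi =>
    .var wk (hξ 0 _ rfl) (inst_mono_iff.2 (hσ Δ' hΔ t hi))

/-! ### Substituting closed values for polymorphic variables -/

theorem HasType.subst₀ {Δ : KEnv Label} {σ : Scheme Label} {e v : Term Label} {t : Ty Label}
    (h : HasType Δ [σ] e t) (hv : HasScheme Δ [] v σ) : HasType Δ [] (e.subst₀ v) t := by
  have := h.subst supports_hasScheme (Δ' := Δ) (Γ' := []) (θ := Ty.fvar)
    (s := fun n => match n with
      | 0 => v
      | n + 1 => .var n) (KEnv.Le.kSub fun _ _ => id) (by simp) (by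
    rintro (_ | n) σ' hn
    · obtain rfl : σ = σ' := by simpa using hn
      rwa [Scheme.subst_fvar]
    · simp at hn)
  rwa [Ty.subst_fvar] at this

theorem HasType.hasScheme_mono {Δ : KEnv Label} {v : Term Label} {t : Ty Label}
    (h : HasType Δ [] v t) : HasScheme Δ [] v (.mono t) := by
  rintro Δ' Γ' ξ hΔ - u wk ⟨⟩
  have := h.rename_of_nil hΔ.kSub wk.env ξ
  rwa [Ty.subst_fvar] at this

/-- In the empty environment every free variable of `t` is generalised, so an instance of the scheme
is a substitution instance of the whole derivation. The target environment need not be related to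
the original one. -/
theorem HasType.hasScheme_gen {Δ Δ₀ : KEnv Label} {ks : ℕ → Kind Label} {as cs : List ℕ}
    {v : Term Label} {t : Ty Label} (h : HasType (Δ₀.extend ks cs) [] v t) (has : as.Nodup)
    (hac : as ⊆ cs) (hast : as.toFinset = t.ftv \ TEnv.ftv ([] : TEnv Label)) :
    HasScheme Δ [] v (.gen ks as t) := by
  rintro Δ' Γ' ξ - - u wk hi
  rw [← Scheme.subst_fvar (Scheme.gen ks as t),
    instTo_subst_gen h.wellKinded.type.lcAt (θ := Ty.fvar) (fun _ => trivial) has] at hi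
  obtain ⟨φ, hφ, rfl⟩ := hi
  have hmas : ∀ a ∈ t.ftv, a ∈ as := by
    intro a ha; rw [← List.mem_toFinset, hast]; simpa [TEnv.ftv] using ha
  choose d hd hd' using exists_hasKindLe (Label := Label)
  -- Variables outside `as` do not occur in `t`, but the derivation may use them and `Δ'` may lack
  -- them. They are sent to closed inhabitants of their kinds.
  have := h.rename_of_nil (Δ' := Δ') (θ := fun a => if a ∈ as then φ a else
    d (((Δ₀.extend ks cs).lookup a).getD .type)) ⟨?_, ?_⟩ wk.env ξ
  · convert this using 1
    refine Ty.subst_congr fun a ha => ?_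
    simp only [hmas a ha, if_true]
  · intro a
    by_cases ha : a ∈ as
    · obtain ⟨κ, hκ, _⟩ := hφ a ha
      simpa only [ha, if_true] using! hκ.lcAt
    · simpa only [ha, if_false] using hd _
  · intro a κ hκ
    by_cases ha : a ∈ as
    · rw [KEnv.lookup_extend, if_pos (hac ha), Option.some.injEq] at hκ
      subst hκ
      simpa only [ha, if_true] using hφ a ha
    · simpa only [ha, if_false, hκ, Option.getD_some] using hd' _ _

end

section

variable {Label : Type u}

/-! ### Inversion of type equality -/

namespace Ty

/-- The outermost constructor. -/
def head : Ty Label → ℕ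
  | fvar _ => 0
  | bvar _ => 1
  | arrow _ _ => 2
  | record _ => 3
  | variant _ => 4
  | mu _ => 5
  | empty => 6
  | cons _ _ _ => 7

/-- The first component of a function type, the row of a record or variant type. -/
def fst : Ty Label → Ty Label
  | arrow t _ => t
  | record ρ => ρ
  | variant ρ => ρ
  | _ => empty

/-- The second component of a function type. -/
def snd : Ty Label → Ty Label
  | arrow _ t => t
  | _ => empty

/-- Unrolls an outermost `α as τ`. -/
def whnf : Ty Label → Ty Label
  | mu τ => τ.unroll
  | t => t

/-- Case analysis cannot invert `Equiv`, because of symmetry and transitivity. Functions compatible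
with it, such as `head`, `fst` and `snd`, take the place of inversion. -/
theorem Equiv.head_eq {t t' : Ty Label} (h : Equiv t t') : t.head = t'.head := by
  induction h with
  | symm _ ih => exact ih.symm
  | trans _ _ ih₁ ih₂ => exact ih₁.trans ih₂
  | _ => rfl

theorem Equiv.fst {t t' : Ty Label} (h : Equiv t t') : Equiv t.fst t'.fst := by
  induction h with
  | symm _ ih => exact ih.symm
  | trans _ _ ih₁ ih₂ => exact ih₁.trans ih₂
  | arrow h | record h | variant h => exact h
  | _ => exact .refl _

theorem Equiv.snd {t t' : Ty Label} (h : Equiv t t') : Equiv t.snd t'.snd := by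
  induction h with
  | symm _ ih => exact ih.symm
  | trans _ _ ih₁ ih₂ => exact ih₁.trans ih₂
  | arrow _ h => exact h
  | _ => exact .refl _

theorem Equiv.inst_right {u u' : Ty Label} (h : Equiv u u') (k : ℕ) (t : Ty Label) :
    Equiv (inst k u t) (inst k u' t) := by
  induction t generalizing k with
  | fvar | empty => exact .refl _
  | bvar n =>
    simp only [inst]
    split
    · exact h
    · exact .refl _
  | arrow _ _ ih₁ ih₂ => exact .arrow (ih₁ k) (ih₂ k)
  | record _ ih => exact .record (ih k)
  | variant _ ih => exact .variant (ih k)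
  | mu _ ih => exact .mu (ih (k + 1))
  | cons l _ _ ih₁ ih₂ => exact .cons l (ih₁ k) (ih₂ k)

theorem Equiv.inst_left {t t' : Ty Label} (h : Equiv t t') (k : ℕ) (u : Ty Label) :
    Equiv (inst k u t) (inst k u t') := by
  induction h generalizing k with
  | refl => exact .refl _
  | symm _ ih => exact (ih k).symm
  | trans _ _ ih₁ ih₂ => exact (ih₁ k).trans (ih₂ k)
  | swap _ _ _ h => exact .swap _ _ _ h
  | arrow _ _ ih₁ ih₂ => exact .arrow (ih₁ k) (ih₂ k)
  | record _ ih => exact .record (ih k)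
  | variant _ ih => exact .variant (ih k)
  | mu _ ih => exact .mu (ih (k + 1))
  | cons l _ _ ih₁ ih₂ => exact .cons l (ih₁ k) (ih₂ k)

theorem Equiv.whnf {t t' : Ty Label} (h : Equiv t t') : Equiv t.whnf t'.whnf := by
  induction h with
  | refl => exact .refl _
  | symm _ ih => exact ih.symm
  | trans _ _ ih₁ ih₂ => exact ih₁.trans ih₂
  | swap _ _ _ h => exact .swap _ _ _ h
  | arrow h₁ h₂ => exact .arrow h₁ h₂
  | record h => exact .record h
  | variant h => exact .variant h
  -- Both the recursive type inserted and the body receiving it change, so they are replaced one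
  -- after the other.
  | mu h => exact ((Equiv.mu h).inst_right 0 _).trans (h.inst_left 0 _)
  | cons l h₁ h₂ => exact .cons l h₁ h₂

/-- The body is an arrow, record or variant, so unrolling never exposes another recursive type;
`whnf` thus agrees on the two sides of `roll` and `unroll`. -/
theorem Contractive.whnf_unroll {τ : Ty Label} (h : Contractive τ) :
    τ.unroll.whnf = τ.unroll := by
  cases h <;> rfl

/-- The row with the fields `ls`. -/
def row (ls : List Label) (t : Label → Ty Label) (ρ : Ty Label) : Ty Label :=
  ls.foldr (fun l r => cons l (t l) r) ρ

theorem row_append (ls ls' : List Label) (t : Label → Ty Label) (ρ : Ty Label) :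
    row (ls ++ ls') t ρ = row ls t (row ls' t ρ) :=
  List.foldr_append

theorem row_congr {ls : List Label} {t t' : Label → Ty Label} {ρ ρ' : Ty Label}
    (h : ∀ l ∈ ls, Equiv (t l) (t' l)) (hρ : Equiv ρ ρ') :
    Equiv (row ls t ρ) (row ls t' ρ') := by
  induction ls with
  | nil => exact hρ
  | cons l ls ih =>
    exact .cons l (h l List.mem_cons_self) (ih fun m hm => h m (List.mem_cons_of_mem _ hm))

theorem row_perm {ls ls' : List Label} (h : ls.Perm ls') (t : Label → Ty Label) (ρ : Ty Label) :
    Equiv (row ls t ρ) (row ls' t ρ) := by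
  induction h with
  | nil => exact .refl _
  | cons l _ ih => exact .cons l (.refl _) ih
  | swap l l' ls =>
    -- Rows may only swap distinct labels. Equal labels carry the same type here, because `t` is a
    -- function of the label.
    by_cases hl : l = l'
    · subst hl; exact .refl _
    · exact .swap _ _ _ (Ne.symm hl)
  | trans _ _ ih₁ ih₂ => exact ih₁.trans ih₂

theorem fields_congr {L : Finset Label} {t t' : L → Ty Label} {ρ ρ' : Ty Label}
    (h : ∀ l, Equiv (t l) (t' l)) (hρ : Equiv ρ ρ') : Equiv (fields L t ρ) (fields L t' ρ') := by
  unfold fields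
  induction L.attach.toList with
  | nil => exact hρ
  | cons l ls ih => exact .cons l.1 (h l) ih

/-! ### Lookup and deletion of fields, up to reordering -/

variable [DecidableEq Label]

/-- Extension of a family of types to all labels. -/
def total {L : Finset Label} (t : L → Ty Label) (l : Label) : Ty Label :=
  if h : l ∈ L then t ⟨l, h⟩ else empty

theorem total_coe {L : Finset Label} (t : L → Ty Label) (l : L) : total t l = t l := by
  simp [total]

/-- Passing to types indexed by all labels allows the label set to vary without transport between
subtypes. -/
theorem fields_equiv_row (L : Finset Label) (t : L → Ty Label) (ρ : Ty Label) :
    Equiv (fields L t ρ) (row L.toList (total t) ρ) := by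
  have h : fields L t ρ = row (L.attach.toList.map Subtype.val) (total t) ρ := by
    simp only [fields, row, List.foldr_map, total_coe]
  rw [h]
  refine row_perm ?_ _ _
  rw [← Multiset.coe_eq_coe, ← Multiset.map_coe, Finset.coe_toList, Finset.coe_toList,
    Finset.attach_val, Multiset.attach_map_val]

/-- The type of the field `l` of a row. -/
def get (l : Label) : Ty Label → Option (Ty Label)
  | cons l' t ρ => if l = l' then some t else get l ρ
  | _ => none

/-- The row without its field `l`. -/
def erase (l : Label) : Ty Label → Ty Label
  | cons l' t ρ => if l = l' then ρ else cons l' t (erase l ρ)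
  | t => t

theorem Equiv.get_rel {t t' : Ty Label} (h : Equiv t t') (l : Label) :
    Option.Rel Equiv (t.get l) (t'.get l) := by
  have hrefl : ∀ o : Option (Ty Label), Option.Rel Equiv o o := by
    rintro (_ | t)
    · exact .none
    · exact .some (.refl t)
  induction h with
  | refl => exact hrefl _
  | symm _ ih =>
    revert ih
    generalize get l _ = o
    generalize get l _ = o'
    rintro (h | _)
    · exact .some h.symm
    · exact .none
  | trans _ _ ih₁ ih₂ =>
    revert ih₁ ih₂
    generalize get l _ = o
    generalize get l _ = o'
    generalize get l _ = o''
    rintro (h | _) (h' | _)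
    · exact .some (h.trans h')
    · exact .none
  | @swap l₁ l₂ _ _ _ hl =>
    simp only [get]
    by_cases h₁ : l = l₁
    · subst h₁
      simpa [hl] using .refl _
    · simp only [h₁, if_false]
      exact hrefl _
  | arrow | record | variant | mu => exact .none
  | cons l' h _ _ ih =>
    simp only [get]
    split
    · exact .some h
    · exact ih

theorem Equiv.get {t t' u : Ty Label} (h : Equiv t t') {l : Label} (hu : t.get l = some u) :
    ∃ u', t'.get l = some u' ∧ Equiv u u' := by
  have := h.get_rel l
  rw [hu] at this
  generalize t'.get l = o at this ⊢
  cases this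
  exact ⟨_, rfl, ‹_›⟩

theorem Equiv.erase {t t' : Ty Label} (h : Equiv t t') (l : Label) :
    Equiv (t.erase l) (t'.erase l) := by
  induction h with
  | refl => exact .refl _
  | symm _ ih => exact ih.symm
  | trans _ _ ih₁ ih₂ => exact ih₁.trans ih₂
  | @swap l₁ l₂ t t' ρ hl =>
    simp only [Ty.erase]
    by_cases h₁ : l = l₁
    · subst h₁
      simpa [hl] using .refl _
    · by_cases h₂ : l = l₂
      · subst h₂
        simpa [h₁] using .refl _
      · simpa [h₁, h₂] using .swap t t' _ hl
  | arrow h₁ h₂ => exact .arrow h₁ h₂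
  | record h => exact .record h
  | variant h => exact .variant h
  | mu h => exact .mu h
  | cons l' h h' ih₁ ih =>
    simp only [Ty.erase]
    split
    · exact h'
    · exact .cons l' h ih

theorem equiv_cons_erase {ρ t : Ty Label} {l : Label} (h : ρ.get l = some t) :
    Equiv ρ (cons l t (ρ.erase l)) := by
  induction ρ with
  | cons l' t' ρ _ ih =>
    simp only [get, erase] at h ⊢
    split at h
    · next hl =>
      subst hl
      obtain rfl : t' = t := by simpa using h
      simpa using .refl _
    · next hl =>
      rw [if_neg hl]
      exact (Equiv.cons l' (.refl _) (ih h)).trans (.swap _ _ _ (Ne.symm hl))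
  | _ => simp [get] at h

theorem get_row (l : Label) (ls : List Label) (t : Label → Ty Label) (ρ : Ty Label) :
    (row ls t ρ).get l = if l ∈ ls then some (t l) else ρ.get l := by
  induction ls with
  | nil => rfl
  | cons m ls ih =>
    change (if l = m then some (t m) else (row ls t ρ).get l) = _
    rw [ih]
    by_cases h : l = m
    · subst h; simp
    · simp [h]

theorem exists_get_fields {L : Finset Label} (t : L → Ty Label) (ρ : Ty Label) (l : L) :
    ∃ u, (fields L t ρ).get l.1 = some u ∧ Equiv u (t l) := by
  obtain ⟨u, hu, he⟩ := (fields_equiv_row L t ρ).symm.get (l := l.1) (u := t l)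
    (by rw [get_row, total_coe]; simp)
  exact ⟨u, hu, he.symm⟩

theorem mem_of_get_fields_empty {L : Finset Label} {t : L → Ty Label} {l : Label} {u : Ty Label}
    (h : (fields L t empty).get l = some u) : ∃ hl : l ∈ L, Equiv (t ⟨l, hl⟩) u := by
  obtain ⟨u', hu, he⟩ := (fields_equiv_row L t empty).get h
  rw [get_row] at hu
  by_cases hl : l ∈ L
  · refine ⟨hl, ?_⟩
    have := total_coe t ⟨l, hl⟩
    simp only [Finset.mem_toList, hl, if_true, Option.some.injEq] at hu
    rw [← this, hu]
    exact he.symm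
  · simp [hl, get] at hu

theorem fields_erase_equiv {L : Finset Label} (t : L → Ty Label) (ρ : Ty Label) (l : L) :
    Equiv ((fields L t ρ).erase l.1)
      (fields (L.erase l.1) (fun m => t ⟨m.1, Finset.mem_of_mem_erase m.2⟩) ρ) := by
  -- With `l` moved to the front, deletion just drops the head.
  have hp : L.toList.Perm (l.1 :: (L.erase l).toList) := by
    have := Finset.toList_insert (Finset.notMem_erase l.1 L)
    rwa [Finset.insert_erase l.2] at this
  have h := ((fields_equiv_row L t ρ).trans (row_perm hp _ _)).erase l.1
  refine h.trans ?_
  change Equiv (if l.1 = l.1 then _ else _) _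
  rw [if_pos rfl]
  refine .trans (row_congr (fun m hm => ?_) (.refl _)) (fields_equiv_row _ _ _).symm
  have hm : m ∈ L.erase l.1 := Finset.mem_toList.1 hm
  have hm' := Finset.mem_of_mem_erase hm
  simp only [total, hm, hm', dif_pos]
  exact .refl _

theorem fields_union_equiv {L M : Finset Label} (hLM : Disjoint L M) (t : L → Ty Label)
    (t' : M → Ty Label) (ρ : Ty Label) :
    Equiv (fields (L ∪ M) (fun m => if h : m.1 ∈ L then t ⟨m.1, h⟩
      else t' ⟨m.1, (Finset.mem_union.1 m.2).resolve_left h⟩) ρ)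
      (fields M t' (fields L t ρ)) := by
  have hp : (L ∪ M).toList.Perm (M.toList ++ L.toList) := by
    rw [List.perm_ext_iff_of_nodup (Finset.nodup_toList _)]
    · intro a; simp [or_comm]
    · refine List.nodup_append'.2 ⟨Finset.nodup_toList _, Finset.nodup_toList _, ?_⟩
      intro a ha hb
      exact Finset.disjoint_left.1 hLM (Finset.mem_toList.1 hb) (Finset.mem_toList.1 ha)
  refine (fields_equiv_row _ _ _).trans ((row_perm hp _ _).trans ?_)
  rw [row_append]
  refine .trans (row_congr (fun m hm => ?_)
    (.trans (row_congr (fun m hm => ?_) (.refl _)) (fields_equiv_row L t ρ).symm))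
    (fields_equiv_row M t' _).symm
  · have hm : m ∈ M := Finset.mem_toList.1 hm
    have hm' : m ∉ L := fun h => Finset.disjoint_left.1 hLM h hm
    simp only [total, Finset.mem_union, hm, hm', or_true, dif_pos, dif_neg, not_false_eq_true]
    exact .refl _
  · have hm : m ∈ L := Finset.mem_toList.1 hm
    simp only [total, Finset.mem_union, hm, true_or, dif_pos]
    exact .refl _

end Ty

/-! ### Kinds of rows -/

variable [DecidableEq Label]

/-- Extensions of a row kind by distinct labels commute, so the field `l` can be treated as the last
one added. -/
theorem HasKind.get_erase {Δ : KEnv Label} {B : List (Kind Label)} {ρ t : Ty Label}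
    {R : RowKind Label} {l : Label} (h : HasKind Δ B ρ (.row R)) (ht : ρ.get l = some t) :
    HasKind Δ B t .type ∧ ∃ R₀, HasKind Δ B (ρ.erase l) (.row R₀) ∧ R₀.Ext l R := by
  induction ρ generalizing R with
  | cons l' t' ρ _ ih =>
    cases h with
    | @cons _ _ _ _ R₁ _ h₁ h₂ hR =>
      simp only [Ty.get, Ty.erase] at ht ⊢
      by_cases hl : l = l'
      · subst hl
        obtain rfl : t' = t := by simpa using ht
        simpa using ⟨h₂, R₁, h₁, hR⟩
      · rw [if_neg hl] at ht ⊢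
        obtain ⟨h₃, R₀, h₄, hR₀⟩ := ih h₁ ht
        refine ⟨h₃, ?_⟩
        cases hR₀ with
        | @pos L _ hL =>
          cases hR with
          | pos hL' =>
            rw [Finset.mem_insert, not_or] at hL'
            refine ⟨_, .cons h₄ h₂ (.pos hL'.2), ?_⟩
            rw [Finset.insert_comm]
            exact .pos (by simp [hl, hL])
        | @neg L _ hL =>
          cases hR with
          | neg hL' =>
            refine ⟨_, .cons h₄ h₂ (.neg (Finset.mem_of_mem_erase hL')), ?_⟩
            rw [Finset.erase_right_comm]
            exact .neg (Finset.mem_erase.2 ⟨hl, hL⟩)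
  | _ => simp [Ty.get] at ht

theorem HasKind.notMem_of_get {Δ : KEnv Label} {B : List (Kind Label)} {ρ t : Ty Label}
    {R : RowKind Label} {M : Finset Label} {l : Label} (h : HasKind Δ B ρ (.row R))
    (hR : R.Sub (.neg M)) (ht : ρ.get l = some t) : l ∉ M := by
  obtain ⟨-, R₀, -, h⟩ := h.get_erase ht
  intro hl
  cases h with
  | pos h =>
    cases hR with
    | pn hR => exact Finset.disjoint_left.1 hR (Finset.mem_insert_self _ _) hl
  | neg h =>
    cases hR with
    | nn hR => exact Finset.notMem_erase _ _ (hR hl)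

theorem hasKind_fields_empty {Δ : KEnv Label} {L : Finset Label} {t : L → Ty Label}
    (h : ∀ l, HasKind Δ [] (t l) .type) :
    ∃ R, HasKind Δ [] (.fields L t .empty) (.row R) := by
  have key : ∀ ls : List L, ls.Nodup → HasKind Δ []
      (ls.foldr (fun l r => Ty.cons l.1 (t l) r) .empty)
      (.row (.pos (ls.map Subtype.val).toFinset)) := by
    intro ls
    induction ls with
    | nil => exact fun _ => .empty
    | cons l ls ih =>
      intro hn
      rw [List.nodup_cons] at hn
      refine .cons (ih hn.2) (h l) ?_
      rw [List.map_cons, List.toFinset_cons]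
      exact .pos (by simpa using hn.1)
  exact ⟨_, key _ (Finset.nodup_toList _)⟩

/-! ### Canonical forms -/

/-- What the syntax-directed rules give for a value `v` of type `t`. -/
inductive Canonical (Δ : KEnv Label) : Term Label → Ty Label → Prop
  | lam {e : Term Label} {t₁ t₂ : Ty Label} :
      HasType Δ [.mono t₁] e t₂ → Canonical Δ (.lam e) (.arrow t₁ t₂)
  | fix {t₁ t₂ : Ty Label} :
      HasKind Δ [] t₁ .type → HasKind Δ [] t₂ .type →
      Canonical Δ .fix (.arrow (.arrow (.arrow t₁ t₂) (.arrow t₁ t₂)) (.arrow t₁ t₂))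
  | label {l : Label} {v : Term Label} {t ρ : Ty Label} :
      HasType Δ [] v t → Canonical Δ (.label l v) (.variant (.cons l t ρ))
  | record {L : Finset Label} {f : L → Term Label} {t : L → Ty Label} :
      (∀ l, HasType Δ [] (f l) (t l)) → Canonical Δ (.record L f) (.record (.fields L t .empty))

/-- Only `unroll`, `roll` and `conv` can follow the syntax-directed rule for a value. The first two
do not change the `whnf` of the type, and the third changes it only by `Equiv`. -/
theorem HasType.canonical {Δ : KEnv Label} {v : Term Label} {t : Ty Label} (hv : Value v)
    (h : HasType Δ [] v t) : ∃ t', Canonical Δ v t' ∧ t'.Equiv t.whnf := by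
  generalize hΓ : ([] : TEnv Label) = Γ at h
  induction h with
  | lam _ h => subst hΓ; exact ⟨_, .lam h, .refl _⟩
  | fix wk =>
    obtain _ | _ | ⟨_, h⟩ := wk.type
    obtain _ | _ | ⟨h₁, h₂⟩ := h
    exact ⟨_, .fix h₁ h₂, .refl _⟩
  | label _ h => subst hΓ; exact ⟨_, .label h, .refl _⟩
  | record t _ h => subst hΓ; exact ⟨_, .record h, .refl _⟩
  | unroll _ h ih =>
    obtain ⟨t', hc, he⟩ := ih hv hΓ
    refine ⟨t', hc, ?_⟩
    have := h.wellKinded.type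
    cases this with
    | mu hτ => rwa [hτ.whnf_unroll]
  | roll wk _ ih =>
    obtain ⟨t', hc, he⟩ := ih hv hΓ
    refine ⟨t', hc, ?_⟩
    cases wk.type with
    | mu hτ => rwa [hτ.whnf_unroll] at he
  | conv _ _ he ih =>
    obtain ⟨t', hc, he'⟩ := ih hv hΓ
    exact ⟨t', hc, he'.trans he.whnf⟩
  | _ => cases hv

theorem HasType.canonical_record {Δ : KEnv Label} {v : Term Label} {ρ : Ty Label} (hv : Value v)
    (h : HasType Δ [] v (.record ρ)) : ∃ (L : Finset Label) (f : L → Term Label)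
      (t : L → Ty Label), v = .record L f ∧ (∀ l, Value (f l)) ∧
      (∀ l, HasType Δ [] (f l) (t l)) ∧ (Ty.fields L t .empty).Equiv ρ := by
  obtain ⟨t', hc, he⟩ := h.canonical hv
  cases hc with
  | record h' =>
    cases hv with
    | record hv => exact ⟨_, _, _, rfl, hv, h', he.fst⟩
  | _ => cases he.head_eq

theorem HasType.canonical_variant {Δ : KEnv Label} {v : Term Label} {ρ : Ty Label} (hv : Value v)
    (h : HasType Δ [] v (.variant ρ)) : ∃ l w t, v = .label l w ∧ Value w ∧
      HasType Δ [] w t ∧ ∃ u, ρ.get l = some u ∧ t.Equiv u := by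
  obtain ⟨t', hc, he⟩ := h.canonical hv
  cases hc with
  | label h' =>
    cases hv with
    | label _ hv => exact ⟨_, _, _, rfl, hv, h', he.fst.get (if_pos rfl)⟩
  | _ => cases he.head_eq

/-! ### Typing the results of record operations and of `fix` -/

theorem HasType.record_of_fields {Δ : KEnv Label} {L : Finset Label} {f : L → Term Label}
    {t : L → Ty Label} {ρ : Ty Label} (h : ∀ l, HasType Δ [] (f l) (t l))
    (he : (Ty.fields L t .empty).Equiv ρ) (wk : WellKinded Δ [] (.record ρ)) :
    HasType Δ [] (.record L f) (.record ρ) := by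
  obtain ⟨R, hR⟩ := hasKind_fields_empty fun l => (h l).wellKinded.type
  exact .conv wk (.record t ⟨by simp, .record hR⟩ h) (.record he)

theorem HasType.fix_unfold {Δ : KEnv Label} {v : Term Label} {t₁ t₂ : Ty Label}
    (h₁ : HasKind Δ [] t₁ .type) (h₂ : HasKind Δ [] t₂ .type)
    (h : HasType Δ [] v (.arrow (.arrow t₁ t₂) (.arrow t₁ t₂))) :
    HasType Δ [] (.app v (.lam (.app (.app .fix v.shift) (.var 0)))) (.arrow t₁ t₂) := by
  have h₁₂ : HasKind Δ [] (.arrow t₁ t₂) .type := .arrow h₁ h₂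
  have hΓ : ∀ σ ∈ [Scheme.mono t₁], σ.WellKinded Δ [] := by simpa [Scheme.WellKinded] using h₁
  have hs := h.rename_of_nil (KEnv.Le.kSub fun _ _ => id) hΓ Nat.succ
  rw [Ty.subst_fvar] at hs
  exact .app ⟨by simp, h₁₂⟩ h (.lam ⟨by simp, h₁₂⟩ (.app ⟨hΓ, h₂⟩
    (.app ⟨hΓ, h₁₂⟩ (.fix ⟨hΓ, .arrow (.arrow h₁₂ h₁₂) h₁₂⟩) hs)
    (.var ⟨hΓ, h₁⟩ rfl (.refl _))))

/-! ### Progress and preservation -/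

/-- Evaluation contexts compose: a context frame around `E` is again an evaluation context. -/
theorem Step.congr {c : Term Label → Term Label} (C : ECtx Label → ECtx Label)
    (hC : ∀ E a, (C E).plug a = c (E.plug a)) {e e' : Term Label} (h : Step e e') :
    Step (c e) (c e') := by
  cases h with
  | context E h =>
    rw [← hC, ← hC]
    exact .context _ h

theorem Reduces.step {e e' : Term Label} (h : Reduces e e') : Step e e' :=
  .context .hole h

/-- Either all fields are values or one of them steps. -/
theorem fields_progress {Δ : KEnv Label} {L : Finset Label} {f : L → Term Label}
    {t : L → Ty Label} (hf : ∀ l, HasType Δ [] (f l) (t l))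
    (ih : ∀ l, Value (f l) ∨ ∃ e', Step (f l) e' ∧ HasType Δ [] e' (t l)) :
    (∀ l, Value (f l)) ∨ ∃ l e', Step (f l) e' ∧
      ∀ m, HasType Δ [] (Function.update f l e' m) (t m) := by
  by_cases h : ∀ l, Value (f l)
  · exact .inl h
  · obtain ⟨l, hl⟩ := not_forall.1 h
    obtain ⟨e', hs, he'⟩ := (ih l).resolve_left hl
    refine .inr ⟨l, e', hs, fun m => ?_⟩
    by_cases hm : m = l
    · subst hm; simpa using he'
    · simpa [hm] using hf m

theorem HasType.app_value {Δ : KEnv Label} {f v : Term Label} {t₁ t₂ : Ty Label} (hf : Value f)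
    (hv : Value v) (h₁ : HasType Δ [] f (.arrow t₁ t₂)) (h₂ : HasType Δ [] v t₁) :
    ∃ e', Step (.app f v) e' ∧ HasType Δ [] e' t₂ := by
  obtain ⟨t', hc, he⟩ := h₁.canonical hf
  have hk₂ : HasKind Δ [] t₂ .type := by cases h₁.wellKinded.type; assumption
  cases hc with
  | @lam e t₁' t₂' h =>
    have hk₁ : HasKind Δ [] t₁' .type := h.wellKinded.env _ List.mem_cons_self
    -- The abstraction's own domain and codomain match the declared ones only up to `Equiv`, so the
    -- argument is converted on the way in and the result on the way out.
    exact ⟨_, (Reduces.app hv).step, .conv ⟨by simp, hk₂⟩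
      (h.subst₀ (HasType.conv ⟨by simp, hk₁⟩ h₂ he.fst.symm).hasScheme_mono) he.snd⟩
  | @fix a b ha hb =>
    have hab : HasKind Δ [] (.arrow a b) .type := .arrow ha hb
    exact ⟨_, (Reduces.fix hv).step, .conv ⟨by simp, hk₂⟩
      (.fix_unfold ha hb (.conv ⟨by simp, .arrow hab hab⟩ h₂ he.fst.symm)) he.snd⟩
  | _ => cases he.head_eq

theorem HasType.progress_preservation {Δ : KEnv Label} {e : Term Label} {t : Ty Label}
    (h : HasType Δ [] e t) : Value e ∨ ∃ e', Step e e' ∧ HasType Δ [] e' t := by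
  generalize hΓ : ([] : TEnv Label) = Γ at h
  induction h with
  | var _ hn => subst hΓ; simp at hn
  | app wk h₁ h₂ ih₁ ih₂ =>
    subst hΓ
    right
    obtain hf | ⟨f', hs, hf'⟩ := ih₁ rfl
    · obtain hv | ⟨e', hs, he'⟩ := ih₂ rfl
      · exact h₁.app_value hf hv h₂
      · exact ⟨_, hs.congr (.appArg _ hf) fun _ _ => rfl, .app wk h₁ he'⟩
    · exact ⟨_, hs.congr (c := fun a => .app a _) (.appFun · _) fun _ _ => rfl, .app wk hf' h₂⟩
  | lam => exact .inl (.lam _)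
  | letIn as ks wk has hasΓ h₁ h₂ ih₁ =>
    subst hΓ
    right
    obtain hv | ⟨e', hs, he'⟩ := ih₁ rfl
    · exact ⟨_, (Reduces.letIn hv).step,
        h₂.subst₀ (h₁.hasScheme_gen has (List.Subset.refl _) hasΓ)⟩
    · exact ⟨_, hs.congr (c := fun a => .letIn a _) (.letIn · _) fun _ _ => rfl,
        .letIn as ks wk has hasΓ he' h₂⟩
  | fix => exact .inl .fix
  | label wk _ hR hR' ih =>
    subst hΓ
    obtain hv | ⟨e', hs, he'⟩ := ih rfl
    · exact .inl (.label _ hv)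
    · exact .inr ⟨_, hs.congr (.label _) fun _ _ => rfl, .label wk he' hR hR'⟩
  | unroll wk _ ih =>
    subst hΓ
    exact (ih rfl).imp_right fun ⟨e', hs, he'⟩ => ⟨e', hs, .unroll wk he'⟩
  | roll wk _ ih =>
    subst hΓ
    exact (ih rfl).imp_right fun ⟨e', hs, he'⟩ => ⟨e', hs, .roll wk he'⟩
  | @record _ _ L f t wk hf ih =>
    subst hΓ
    obtain hv | ⟨l, e', hs, he'⟩ := fields_progress hf fun l => ih l rfl
    · exact .inl (.record hv)
    · refine .inr ⟨_, ?_, .record t wk he'⟩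
      -- Plugging `f l` back into the field `l` leaves `f` unchanged.
      have := hs.congr (c := fun a => .record L (Function.update f l a)) (.record L f l)
        fun _ _ => rfl
      simpa using this
  | @modify _ _ e M g ρ t wk h₁ hg ih₁ ih₂ =>
    subst hΓ
    right
    obtain hv | ⟨e', hs, he'⟩ := ih₁ rfl
    · obtain hg' | ⟨l, e', hs, he'⟩ := fields_progress hg fun l => ih₂ l rfl
      · obtain ⟨L, f, t', rfl, hf, hft, he⟩ := h₁.canonical_record hv
        -- The row of the value ends in `·`, so every label that the type mentions is one of its
        -- actual fields, and with an equivalent type.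
        have hM : ∀ m : M, ∃ hm : m.1 ∈ L, (t' ⟨m.1, hm⟩).Equiv (t m) := by
          intro m
          obtain ⟨u, hu, hut⟩ := Ty.exists_get_fields t ρ m
          obtain ⟨u', hu', huu'⟩ := he.symm.get hu
          obtain ⟨hm, h⟩ := Ty.mem_of_get_fields_empty hu'
          exact ⟨hm, (h.trans huu'.symm).trans hut⟩
        refine ⟨_, (Reduces.modify (fun m hm => (hM ⟨m, hm⟩).1) hf hg').step,
          .record_of_fields (fun l => ?_) he wk⟩
        by_cases hl : l.1 ∈ M
        · simp only [hl, dif_pos]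
          obtain ⟨_, h⟩ := hM ⟨l, hl⟩
          exact .conv (hft l).wellKinded (hg _) h.symm
        · simpa only [hl, dif_neg, not_false_eq_true] using hft l
      · refine ⟨_, ?_, .modify t wk h₁ he'⟩
        have := hs.congr (c := fun a => .modify e M (Function.update g l a))
          (.modifyField e hv M g l) fun _ _ => rfl
        simpa using this
    · exact ⟨_, hs.congr (c := fun a => .modify a M g) (.modify · M g) fun _ _ => rfl,
        .modify t wk he' hg⟩
  | @extend _ _ e M g ρ R t wk h₁ hR hR' hg ih₁ ih₂ =>
    subst hΓ
    right
    obtain hv | ⟨e', hs, he'⟩ := ih₁ rfl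
    · obtain hg' | ⟨l, e', hs, he'⟩ := fields_progress hg fun l => ih₂ l rfl
      · obtain ⟨L, f, t', rfl, hf, hft, he⟩ := h₁.canonical_record hv
        -- Each field of the value occurs in `ρ`, whose kind excludes the labels of `M`.
        have hLM : Disjoint L M := by
          refine Finset.disjoint_left.2 fun l hl => ?_
          obtain ⟨u, hu, -⟩ := Ty.exists_get_fields t' .empty ⟨l, hl⟩
          obtain ⟨u', hu', -⟩ := he.get hu
          exact hR.notMem_of_get hR' hu'
        refine ⟨_, (Reduces.extend hLM hf hg').step, .record_of_fields (fun l => ?_)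
          ((Ty.fields_union_equiv hLM t' t .empty).trans
            (Ty.fields_congr (fun _ => .refl _) he)) wk⟩
        by_cases hl : l.1 ∈ L
        · simpa only [hl, dif_pos] using hft _
        · simpa only [hl, dif_neg, not_false_eq_true] using hg _
      · refine ⟨_, ?_, .extend t wk h₁ hR hR' he'⟩
        have := hs.congr (c := fun a => .extend e M (Function.update g l a))
          (.extendField e hv M g l) fun _ _ => rfl
        simpa using this
    · exact ⟨_, hs.congr (c := fun a => .extend a M g) (.extend · M g) fun _ _ => rfl,
        .extend t wk he' hR hR' hg⟩
  | @access _ _ e l t ρ wk h ih =>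
    subst hΓ
    right
    obtain hv | ⟨e', hs, he'⟩ := ih rfl
    · obtain ⟨L, f, t', rfl, hf, hft, he⟩ := h.canonical_record hv
      obtain ⟨u, hu, hut⟩ := he.symm.get (l := l) (if_pos rfl)
      obtain ⟨hl, h'⟩ := Ty.mem_of_get_fields_empty hu
      exact ⟨_, (Reduces.access ⟨l, hl⟩ hf).step, .conv wk (hft _) (h'.trans hut.symm)⟩
    · exact ⟨_, hs.congr (c := fun a => .access a l) (.access · l) fun _ _ => rfl,
        .access wk he'⟩
  | @delete _ _ e l t ρ wk h ih =>
    subst hΓ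
    right
    obtain hv | ⟨e', hs, he'⟩ := ih rfl
    · obtain ⟨L, f, t', rfl, hf, hft, he⟩ := h.canonical_record hv
      obtain ⟨u, hu, hut⟩ := he.symm.get (l := l) (if_pos rfl)
      obtain ⟨hl, h'⟩ := Ty.mem_of_get_fields_empty hu
      have hr := he.erase l
      rw [show (Ty.cons l t ρ).erase l = ρ from if_pos rfl] at hr
      exact ⟨_, (Reduces.delete ⟨l, hl⟩ hf).step, .record_of_fields (fun m => hft _)
        ((Ty.fields_erase_equiv t' .empty ⟨l, hl⟩).symm.trans hr) wk⟩
    · exact ⟨_, hs.congr (c := fun a => .delete a l) (.delete · l) fun _ _ => rfl,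
        .delete wk he'⟩
  | matchVoid wk h ih =>
    subst hΓ
    right
    obtain hv | ⟨e', hs, he'⟩ := ih rfl
    · obtain ⟨l, w, t, -, -, -, u, hu, -⟩ := h.canonical_variant hv
      -- The tag of the value would have to be a field of the empty row.
      cases hu
    · exact ⟨_, hs.congr .matchVoid fun _ _ => rfl, .matchVoid wk he'⟩
  | matchUnit wk h h₁ ih =>
    subst hΓ
    right
    obtain hv | ⟨e', hs, he'⟩ := ih rfl
    · obtain ⟨L, f, t', rfl, hf, hft, he⟩ := h.canonical_record hv
      obtain rfl : L = ∅ := by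
        refine Finset.eq_empty_of_forall_notMem fun l hl => ?_
        obtain ⟨u, hu, -⟩ := Ty.exists_get_fields t' .empty ⟨l, hl⟩
        obtain ⟨u', hu', -⟩ := he.get hu
        cases hu'
      exact ⟨_, Reduces.matchUnit.step, h₁⟩
    · exact ⟨_, hs.congr (c := fun a => .matchUnit a _) (.matchUnit · _) fun _ _ => rfl,
        .matchUnit wk he' h₁⟩
  | @matchLabel _ _ e e₁ e₂ l t ρ t' as bs ks wk has hasΓ hbs hbsΓ h h₁ h₂ ih =>
    subst hΓ
    right
    obtain hv | ⟨e', hs, he'⟩ := ih rfl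
    · obtain ⟨l', w, u, rfl, hw, hwu, u', hu', huu'⟩ := h.canonical_variant hv
      obtain ⟨hkt, hkρ⟩ := h.wellKinded.type.of_variant_cons
      by_cases hl : l' = l
      · subst hl
        obtain rfl : t = u' := by simpa [Ty.get] using hu'
        exact ⟨_, (Reduces.matchLabel hw).step, h₁.subst₀ (HasType.hasScheme_gen
          (.conv ⟨by simp, hkt⟩ hwu huu') has (List.subset_append_left _ _) hasΓ)⟩
      · simp only [Ty.get, hl, if_false] at hu'
        cases hkρ with
        | variant hρ =>
          obtain ⟨hu, R₀, hk, hR₀⟩ := hρ.get_erase hu'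
          -- The tagged value is typed afresh at the smaller variant: bringing its field `l'` to the
          -- front of `ρ` leaves a rest whose kind excludes `l'`, as the rule for labels demands.
          have hty := HasType.conv (e := .label l' w) ⟨by simp, .variant hρ⟩
            (.label ⟨by simp, .variant (.cons hk hu hR₀)⟩ (.conv ⟨by simp, hu⟩ hwu huu') hk
              hR₀.sub_neg) (.variant (Ty.equiv_cons_erase hu').symm)
          exact ⟨_, (Reduces.matchSkip hw hl).step,
            h₂.subst₀ (hty.hasScheme_gen hbs (List.subset_append_right _ _) hbsΓ)⟩
    · exact ⟨_, hs.congr (c := fun a => .matchLabel a l e₁ e₂) (.matchLabel · l e₁ e₂)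
        fun _ _ => rfl, .matchLabel as bs ks wk has hasΓ hbs hbsΓ he' h₁ h₂⟩
  | conv wk _ he ih =>
    subst hΓ
    exact (ih rfl).imp_right fun ⟨e', hs, he'⟩ => ⟨e', hs, .conv wk he' he⟩

end

end Elevate

/-- Type soundness. -/
theorem mainTheorem1 {Label : Type*} [DecidableEq Label] (Δ : Elevate.KEnv Label)
    (e : Elevate.Term Label) (t : Elevate.Ty Label) (h : Elevate.HasType Δ [] e t) :
    Elevate.Value e ∨ ∃ e' : Elevate.Term Label, Elevate.Step e e' ∧ Elevate.HasType Δ [] e' t :=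
  h.progress_preservation
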